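/- Let $d\ge 2$ and let $\Gamma^d=(V,L)$ be the Cayley tree of order $d$ (the tree in which every vertex has exactly $d+1$ neighbours). Let $Q:\mathbb Z\to(0,\infty)$ be an even function with $Q(0)=1$. A *path of length $n$* is a sequence of $n+1$ distinct, consecutively adjacent vertices. A *gradient configuration* assigns to every oriented edge an integer $\eta_{(x,y)}=-\eta_{(y,x)}$, and the total increment $W_n$ along a path $(x_0,\dots,x_n)$ is $\sum_{m=1}^{n}\eta_{(x_{m-1},x_m)}$. For a path of length $n$ depending on $n$, the limits below hold for every choice of the paths. *Markov chains of boundary laws.* Let $S=\mathbb Z$ or $\mathbb Z_q$, and let $R:S\to(0,\infty)$ be even. A (homogeneous) boundary law for $R$ is a function $\lambda:S\to(0,\infty)$ such that, for some $c>0$, $\lambda(i)=c\big(\sum_{j\in S}R(i-j)\lambda(j)\big)^d$ for all $i\in S$, with finite sums. The tree-indexed Markov chain associated with $(R,\lambda)$ is the probability measure $\mu$ on $S^V$ with $$\mu(\sigma_{\Lambda\cup\partial\Lambda}=\omega_{\Lambda\cup\partial\Lambda})=Z_\Lambda^{-1}\prod_{y\in\partial\Lambda}\lambda(\omega_y)\prod_{\{x,y\}\in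 L,\ \{x,y\}\cap\Lambda\ne\emptyset}R(\omega_x-\omega_y)$$ for all finite non-empty connected $\Lambda\subset V$ and all $\omega\in S^V$, where $\partial\Lambda$ is the outer vertex boundary of $\Lambda$ and $Z_\Lambda>0$ is the normalization constant. *Periodic gradient measures.* Let $q\ge1$ and let $\lambda_q:\mathbb Z\to(0,\infty)$ be a $q$-periodic boundary law for $Q$ (so $Q\in\ell_1(\mathbb Z)$). Put $Q_q(\bar s)=\sum_{l\in\bar s}Q(l)$ for $\bar s\in\mathbb Z_q$, and $\rho_q^Q(j\mid\bar s)=1_{\{j\in\bar s\}}Q(j)/Q_q(\bar s)$. Let $P$ be the tree-indexed Markov chain on $\mathbb Z_q^V$ associated with $Q_q$ and with $\lambda_q$ regarded as a function on $\mathbb Z_q$. The gradient measure $\nu^{\lambda_q}$ is the probability measure on gradient configurations under which, conditionally on $\sigma'\sim P$, the increments along different edges are independent and $\eta_{(x,y)}$ has law $\rho_q^Q(\cdot\mid\sigma'_y-\sigma'_x)$. *Localized Gibbs measures.* Let $G_d$ be the set of all $(\gamma,\delta)\in(1,\infty)\times(0,\infty)$ for which there is an $\varepsilon>0$ with $$\delta+\gamma\varepsilon^d\le\varepsilon\quad\text{and}\quad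 2d\gamma\varepsilon^{d-1}+2d\delta\varepsilon^d<1 .\qquad(*)$$ Assume $\gamma:=\|Q\|_{\ell_{(d+1)/2}(\mathbb Z)}<\infty$, put $\delta:=\|Q\|_{\ell_{d+1}(\mathbb Z\setminus\{0\})}$, and assume $(\gamma,\delta)\in G_d$. A localized boundary law is a function $\lambda=x^d$, where $x:\mathbb Z\to\mathbb R$ satisfies $x(0)=1$, $\|x\|_{\ell_{d+1}(\mathbb Z\setminus\{0\})}\le\varepsilon$ for some $\varepsilon>0$ as in $(*)$, and $$x(i)=\frac{Q(i)+\sum_{j\ne0}Q(i-j)|x(j)|^d}{1+\sum_{j\ne0}Q(j)|x(j)|^d}\qquad(i\ne0).$$ For $i\in\mathbb Z$ the localized Gibbs measure $\mu_i$ is the tree-indexed Markov chain on $\mathbb Z^V$ associated with $(Q,\lambda(\cdot-i))$. Its gradient projection $\nu$ is the law of $\eta_{(x,y)}=\sigma_y-\sigma_x$ under $\mu_i$. **Theorem.** 1. For every $q\ge 1$ and every $q$-periodic boundary law $\lambda_q$ for $Q$, the measure $\nu^{\lambda_q}$ exists and delocalizes: for every $k\in\mathbb Z$, $\nu^{\lambda_q}(W_n=k)\to0$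 as $n\to\infty$. 2. If $\gamma<\infty$ and $(\gamma,\delta)\in G_d$, then a localized boundary law $\lambda$ exists. For each such $\lambda$ and each $i\in\mathbb Z$ the measure $\mu_i$ exists, and its gradient projection $\nu$ is localized: for every $k\in\mathbb Z$, as $n\to\infty$, $$\nu(W_n=k)\longrightarrow\sum_{j\in\mathbb Z}\alpha(j)\alpha(j+k)>0,\qquad \alpha(j)=\frac{\lambda(j)^{(d+1)/d}}{\sum_{l\in\mathbb Z}\lambda(l)^{(d+1)/d}} .$$ 3. Under the assumptions of 2, the gradient projection of each $\mu_i$ is different from $\nu^{\lambda_q}$ for every $q$-periodic boundary law $\lambda_q$ for $Q$. -/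

import Mathlib

open MeasureTheory Filter Topology

noncomputable section

/-! ### Gradient configurations on a graph -/

section Gradients

variable {V : Type*}

/-- Gradient configurations: integer increments on the oriented edges that change sign when the
orientation is reversed.  On a tree these are exactly the height differences of height
configurations. -/
abbrev GradConfig (G : SimpleGraph V) : Type _ :=
  {η : G.Dart → ℤ // ∀ e : G.Dart, η e.symm = -η e}

/-- The projection of a height configuration to its gradients,
`η_(x,y) = σ_y - σ_x` on the oriented edge `(x,y)`. -/
def gradProj (G : SimpleGraph V) (σ : V → ℤ) : GradConfig G :=
  ⟨fun e => σ e.snd - σ e.fst, fun e => by simp⟩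

theorem measurable_gradProj (G : SimpleGraph V) : Measurable (gradProj G) := by
  refine Measurable.subtype_mk (measurable_pi_lambda _ fun e => ?_)
  exact (measurable_pi_apply _).sub (measurable_pi_apply _)

/-- The total increment along a walk: the sum of the increments of its oriented edges. -/
def totalIncrement {G : SimpleGraph V} {x y : V} (p : G.Walk x y) (η : GradConfig G) : ℤ :=
  (p.darts.map η.1).sum

end Gradients

/-! ### Tree-indexed Markov chains associated with homogeneous boundary laws

The local state space `S` is `ℤ` or `ZMod q`. -/

section BoundaryLaws

variable {V S : Type*} [AddCommGroup S]

/-- The outer boundary `∂Λ` of a finite volume. -/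
def outerBoundary (G : SimpleGraph V) [G.LocallyFinite] (Λ : Finset V) : Finset V :=
  open Classical in (Λ.biUnion fun x => G.neighborFinset x) \ Λ

/-- The (unoriented) edges `b` with `b ∩ Λ ≠ ∅`. -/
def edgesMeeting (G : SimpleGraph V) [G.LocallyFinite] (Λ : Finset V) : Finset (Sym2 V) :=
  open Classical in Λ.biUnion fun x => G.incidenceFinset x

/-- The weight `Q_b(ω_b) = Q(ω_x - ω_y)` of the edge `b = {x,y}`. -/
def edgeWeight (Q : S → ℝ) (hQ : Function.Even Q) (ω : V → S) : Sym2 V → ℝ :=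
  Sym2.lift ⟨fun x y => Q (ω x - ω y), fun x y => by
    simpa using hQ (ω y - ω x)⟩

/-- Positive spatially homogeneous boundary laws on the Cayley tree of order `d`:
`λ(i) = c (∑_j Q(i-j) λ(j))^d` with finite sums and a constant `c > 0`. -/
structure IsHomBoundaryLaw (d : ℕ) (Q lam : S → ℝ) : Prop where
  pos : ∀ i, 0 < lam i
  summable : ∀ i, Summable fun j => Q (i - j) * lam j
  eqn : ∃ c : ℝ, 0 < c ∧ ∀ i, lam i = c * (∑' j, Q (i - j) * lam j) ^ d

/-- `μ` is the tree-indexed Markov chain associated with the homogeneous boundary law `lam` for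
the transfer operator `Q`: for finite connected `Λ`,
`μ(σ_{Λ∪∂Λ} = ω_{Λ∪∂Λ}) = Z_Λ⁻¹ ∏_{y ∈ ∂Λ} λ(ω_y) ∏_{b ∩ Λ ≠ ∅} Q_b(ω_b)`.
As `μ` is a probability measure, the constant `Z_Λ` is the normalization constant. -/
structure IsBoundaryLawChain [MeasurableSpace S] (G : SimpleGraph V) [G.LocallyFinite]
    (Q : S → ℝ) (hQ : Function.Even Q) (lam : S → ℝ) (μ : Measure (V → S)) : Prop where
  prob : IsProbabilityMeasure μ
  marginal : ∀ Λ : Finset V, (G.induce (Λ : Set V)).Connected →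
    ∃ Z : ℝ, 0 < Z ∧ ∀ ω : V → S,
      μ.real {σ | (∀ x ∈ Λ, σ x = ω x) ∧ ∀ y ∈ outerBoundary G Λ, σ y = ω y} =
        Z⁻¹ * (∏ y ∈ outerBoundary G Λ, lam (ω y)) * ∏ b ∈ edgesMeeting G Λ, edgeWeight Q hQ ω b

end BoundaryLaws

/-! ### Gradient measures of height-periodic boundary laws -/

/-- The fuzzy transfer operator `Q_q(s) = ∑_{l ∈ s} Q(l)` on `ℤ/qℤ`. -/
def fuzzyQ (Q : ℤ → ℝ) (q : ℕ) (s : ZMod q) : ℝ :=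
  ∑' l : {l : ℤ // (l : ZMod q) = s}, Q l

theorem fuzzyQ_even {Q : ℤ → ℝ} (hQ : Function.Even Q) (q : ℕ) :
    Function.Even (fuzzyQ Q q) := by
  intro s
  let e : {l : ℤ // (l : ZMod q) = s} ≃ {l : ℤ // (l : ZMod q) = -s} :=
    (Equiv.neg ℤ).subtypeEquiv fun a => by simp
  unfold fuzzyQ
  rw [← e.tsum_eq]
  exact tsum_congr fun l => hQ l.1

/-- The function on `ℤ/qℤ` induced by a `q`-periodic function on `ℤ`. -/
def onResidues (q : ℕ) (lam : ℤ → ℝ) (s : ZMod q) : ℝ := lam (s.val : ℤ)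

/-- The law `ρ_q^Q(j | s) = 1_{j ∈ s} Q(j) / Q_q(s)` of an increment given its residue class. -/
def incrementLaw (Q : ℤ → ℝ) (q : ℕ) (j : ℤ) (s : ZMod q) : ℝ :=
  open Classical in if (j : ZMod q) = s then Q j / fuzzyQ Q q s else 0

/-- `ν` is the gradient measure `ν^λ` of the `q`-periodic boundary law `lam`, obtained by the
two-layer construction: `P` is the law of the fuzzy chain, that is, the tree-indexed Markov chain
on `ℤ/qℤ` associated with `lam` for `Q_q`; given the fuzzy chain `σ'`, the increments along
different edges are independent, and the one along `(x,y)` has the law `ρ_q^Q(· | σ'_y - σ'_x)`.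
A finite set `A` of oriented edges here contains each edge with at most one orientation, as the
increment in the opposite direction is determined; all edges inside a finite volume is one
choice of `A`, for any choice of orientations. -/
structure IsPeriodicGradientMeasure {V : Type*} (G : SimpleGraph V) [G.LocallyFinite]
    (Q : ℤ → ℝ) (hQ : Function.Even Q) (q : ℕ) (lam : ℤ → ℝ) (ν : Measure (GradConfig G)) :
    Prop where
  prob : IsProbabilityMeasure ν
  marginal : ∃ P : Measure (V → ZMod q),
    IsBoundaryLawChain G (fuzzyQ Q q) (fuzzyQ_even hQ q) (onResidues q lam) P ∧
    ∀ A : Finset G.Dart, (∀ e ∈ A, e.symm ∉ A) → ∀ ζ : G.Dart → ℤ,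
      ν.real {η | ∀ e ∈ A, η.1 e = ζ e} =
        ∫ σ', ∏ e ∈ A, incrementLaw Q q (ζ e) (σ' e.snd - σ' e.fst) ∂P

/-! ### Localized Gibbs measures -/

/-- Membership in `ℓ_p(S)` for `S ⊆ ℤ`. -/
def MemEll (p : ℝ) (S : Set ℤ) (x : ℤ → ℝ) : Prop :=
  Summable fun j : S => |x j| ^ p

/-- The norm `‖x‖_{p,S} = (∑_{j ∈ S} |x(j)|^p)^{1/p}` of an `x ∈ ℓ_p(S)`. -/
def ellNorm (p : ℝ) (S : Set ℤ) (x : ℤ → ℝ) : ℝ :=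
  (∑' j : S, |x j| ^ p) ^ (1 / p)

/-- The condition on the radius `ε` in the definition of the good set. -/
def IsGoodRadius (d : ℕ) (γ δ ε : ℝ) : Prop :=
  0 < ε ∧ δ + γ * ε ^ d ≤ ε ∧ 2 * d * γ * ε ^ (d - 1) + 2 * d * δ * ε ^ d < 1

/-- The good set `G_d ⊆ (1,∞) × (0,∞)`. -/
def goodSet (d : ℕ) : Set (ℝ × ℝ) :=
  {z | 1 < z.1 ∧ 0 < z.2 ∧ ∃ ε : ℝ, IsGoodRadius d z.1 z.2 ε}

/-- The operator `T` whose fixed points are the `d`-th roots of normalized boundary laws. -/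
def rootOperator (d : ℕ) (Q x : ℤ → ℝ) (i : ℤ) : ℝ :=
  (Q i + ∑' j : ({0}ᶜ : Set ℤ), Q (i - j) * |x j| ^ d) /
    (1 + ∑' j : ({0}ᶜ : Set ℤ), Q j * |x j| ^ d)

/-- The localized boundary law around height `0`: it is `λ = x^d`, where `x(0) = 1` and, off `0`,
`x` is the fixed point of `T` in a ball of `ℓ_{d+1}(ℤ ∖ {0})` about zero whose radius is
admissible in the definition of the good set. -/
def IsLocalizedBoundaryLaw (d : ℕ) (Q lam : ℤ → ℝ) : Prop :=
  ∃ (ε : ℝ) (x : ℤ → ℝ),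
    IsGoodRadius d (ellNorm (((d : ℝ) + 1) / 2) Set.univ Q) (ellNorm ((d : ℝ) + 1) {0}ᶜ Q) ε ∧
    MemEll ((d : ℝ) + 1) {0}ᶜ x ∧ ellNorm ((d : ℝ) + 1) {0}ᶜ x ≤ ε ∧
    x 0 = 1 ∧ (∀ i ≠ 0, x i = rootOperator d Q x i) ∧ ∀ i, lam i = x i ^ d

/-- `μ` is the localized Gibbs measure `μ_i` around height `i`: the tree-indexed Markov chain
associated with the translate `λ(· - i)` of the localized boundary law `lam`. -/
def IsLocalizedGibbsMeasure {V : Type*} (G : SimpleGraph V) [G.LocallyFinite]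
    (Q : ℤ → ℝ) (hQ : Function.Even Q) (lam : ℤ → ℝ) (i : ℤ) (μ : Measure (V → ℤ)) : Prop :=
  IsBoundaryLawChain G Q hQ (fun j => lam (j - i)) μ

/-- The stationary distribution `α(i) = λ(i)^{(d+1)/d} / ∑_j λ(j)^{(d+1)/d}`. -/
def stationaryLaw (d : ℕ) (lam : ℤ → ℝ) (i : ℤ) : ℝ :=
  lam i ^ (((d : ℝ) + 1) / d) / ∑' j, lam j ^ (((d : ℝ) + 1) / d)

end

/-! Both kinds of measures are governed by a function y > 0 with ∑_j Q(i-j) y(j)^d = C y(i), which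
is the d-th root of the boundary law up to a constant. On a finite subtree T the chain has a
marginal proportional to `treeWeight`: the edge weights times one factor y for every neighbour
missing in T. Summing out a leaf by the eigenvalue equation only multiplies this by C, so the family
is consistent and describes a Markov chain with P(i,j) = Q(i-j) y(j)^d / (C y(i)), reversible with
respect to y^(d+1).

If y^(d+1) is summable, its normalization α is an invariant law, and the chain can be built outwards
from a root (`IsRootOfBoundaryLaw.exists_isBoundaryLawChain`). Along a path of length n the
endpoints have joint law α(i) P^n(i,j) (`measureReal_two_point`). All entries of P are positive, so
P^n(i,j) → α(j) (`tendsto_iterate_markovApply`), and dominated convergence gives the limit ∑ α(j)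
α(j+k) > 0 for the increments. The localized y itself is a Banach fixed point in a ball of ℓ_(d+1).
Writing Q = (√Q)², the Hölder and Young inequalities bound numerator and denominator of the operator
(`exists_conv`, `summable_pairing`); the two inequalities for a good radius say that the ball is
preserved and that the contraction constant is below 1.

For a q-periodic boundary law the state space is finite, so the same construction yields the fuzzy
chain. Conditionally on it, W_n is a sum of n independent integers, each charging two points at
distance q with mass at least some θ > 0 that does not depend on the residue classes. Each
characteristic function is therefore bounded by `charBound`, which is below 1 off finitely many
points of the circle, and Fourier inversion bounds the probability of {W_n = k} by ∫ charBound^n → 0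
(`measureReal_pi_sum_eq_le`, `tendsto_integral_charBound_pow`).

The limits 0 and ∑ α(j)² > 0 are incompatible along any sequence of paths of length n, so the two
kinds of gradient measures differ. -/

noncomputable section

/-! ### Finite subtrees and paths in acyclic graphs -/

section TreeCombinatorics

open SimpleGraph

variable {V : Type*} {G : SimpleGraph V}

/-- In an acyclic graph a vertex outside a connected set has at most one neighbour in the set. -/
theorem SimpleGraph.IsAcyclic.eq_of_adj_of_adj (hG : G.IsAcyclic) {T : Set V}
    (hT : (G.induce T).Connected) {v u w : V} (hv : v ∉ T) (hu : u ∈ T) (hw : w ∈ T)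
    (hvu : G.Adj v u) (hvw : G.Adj v w) : u = w := by
  classical
  obtain ⟨p, hp⟩ := (hT.preconnected ⟨u, hu⟩ ⟨w, hw⟩).exists_isPath
  let f : G.induce T →g G := (Embedding.induce T).toHom
  have hf : Function.Injective f := (Embedding.induce (G := G) T).injective
  let p' : G.Walk u w := p.map f
  have hp' : p'.IsPath := Walk.IsPath.map hf hp
  have hvp : v ∉ p'.support := by
    intro h
    have h' : v ∈ (p.map f).support := h
    rw [Walk.support_map, List.mem_map] at h'
    obtain ⟨a, -, ha⟩ := h'
    exact hv (ha ▸ a.2)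
  have h1 : (Walk.cons hvu p').IsPath := by
    rw [Walk.cons_isPath_iff]; exact ⟨hp', hvp⟩
  have h2 : (Walk.cons hvw Walk.nil).IsPath := by
    simp [Walk.cons_isPath_iff, hvw.ne]
  -- The path through u and the single edge join the same endpoints; uniqueness of paths puts u on
  -- the edge {v, w}.
  have h3 := (hG.subsingleton_path v w).elim ⟨_, h1⟩ ⟨_, h2⟩
  have h4 : (Walk.cons hvu p').support = (Walk.cons hvw Walk.nil).support := by
    rw [Subtype.mk.injEq] at h3; rw [h3]
  have h5 : u ∈ (Walk.cons hvu p').support := by simp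
  rw [h4] at h5
  simp only [Walk.support_cons, Walk.support_nil, List.mem_cons, List.not_mem_nil, or_false] at h5
  rcases h5 with h5 | h5
  · exact absurd h5 hvu.symm.ne
  · exact h5

theorem SimpleGraph.Connected.induce_insert {T : Set V} (hT : (G.induce T).Connected) {u v : V}
    (hu : u ∈ T) (huv : G.Adj u v) : (G.induce (insert v T)).Connected := by
  have h1 : (G.induce ({u, v} : Set V)).Connected := induce_pair_connected_of_adj huv
  have h2 : insert v T = T ∪ {u, v} := by
    ext w; simp only [Set.mem_insert_iff, Set.mem_union, Set.mem_singleton_iff]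
    constructor
    · rintro (h | h) <;> tauto
    · rintro (h | h | h)
      · tauto
      · subst h; tauto
      · tauto
  rw [h2]
  exact induce_union_connected hT.preconnected h1.preconnected ⟨u, hu, by simp⟩

theorem SimpleGraph.connected_induce_singleton (r : V) :
    (G.induce ({r} : Set V)).Connected := by
  have : Subsingleton ({r} : Set V) := by infer_instance
  exact ⟨Preconnected.of_subsingleton⟩

/-- Between two nested connected finite sets one can interpolate by adding one vertex at a time. -/
theorem SimpleGraph.Connected.growth_induction [DecidableEq V] {T T' : Finset V}
    (hT : (G.induce (T : Set V)).Connected) (hT' : (G.induce (T' : Set V)).Connected)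
    (hsub : T ⊆ T') {motive : Finset V → Prop} (base : motive T)
    (step : ∀ (U : Finset V) (u v : V), (G.induce (U : Set V)).Connected → T ⊆ U → u ∈ U →
      G.Adj u v → v ∉ U → insert v U ⊆ T' → motive U → motive (insert v U)) : motive T' := by
  suffices H : ∀ (n : ℕ) (U : Finset V), (T' \ U).card = n → (G.induce (U : Set V)).Connected →
      T ⊆ U → U ⊆ T' → motive U → motive T' from H _ T rfl hT subset_rfl hsub base
  intro n
  induction n with
  | zero =>
    intro U hU _ _ hUT' hm
    rw [Finset.card_eq_zero, Finset.sdiff_eq_empty_iff_subset] at hU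
    rwa [← hUT'.antisymm hU]
  | succ n ih =>
    intro U hU hUc hTU hUT' hm
    obtain ⟨w, hw⟩ : (T' \ U).Nonempty := by
      rw [← Finset.card_pos]; omega
    rw [Finset.mem_sdiff] at hw
    obtain ⟨⟨t, ht⟩⟩ := hUc.nonempty
    obtain ⟨p⟩ := hT'.preconnected ⟨t, hUT' ht⟩ ⟨w, hw.1⟩
    -- A walk inside T' from U to a missing vertex leaves U along some edge, whose far end is the
    -- next vertex to add.
    obtain ⟨e, -, he1, he2⟩ := p.exists_boundary_dart {a | (a : V) ∈ U} ht hw.2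
    have hadj : G.Adj (e.fst : V) e.snd := e.adj
    have hins : insert (e.snd : V) U ⊆ T' := Finset.insert_subset e.snd.2 hUT'
    refine ih (insert (e.snd : V) U) ?_ ?_ (hTU.trans (Finset.subset_insert _ _)) hins
      (step U e.fst e.snd hUc hTU he1 hadj he2 hins hm)
    · have h1 : T' \ insert (e.snd : V) U = (T' \ U).erase e.snd := by
        ext a; simp only [Finset.mem_sdiff, Finset.mem_insert, Finset.mem_erase]; tauto
      rw [h1, Finset.card_erase_of_mem, hU]
      · rfl
      · rw [Finset.mem_sdiff]; exact ⟨e.snd.2, he2⟩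
    · rw [Finset.coe_insert]
      exact hUc.induce_insert he1 hadj

theorem SimpleGraph.Walk.connected_induce_support_toFinset [DecidableEq V] {x y : V}
    (p : G.Walk x y) : (G.induce (p.support.toFinset : Set V)).Connected := by
  have := p.connected_induce_support
  convert this using 2 <;> ext a <;> simp

variable [G.LocallyFinite]

theorem mem_outerBoundary {Λ : Finset V} {v : V} :
    v ∈ outerBoundary G Λ ↔ v ∉ Λ ∧ ∃ u ∈ Λ, G.Adj u v := by
  classical
  simp only [outerBoundary, Finset.mem_sdiff, Finset.mem_biUnion, mem_neighborFinset]
  tauto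

theorem mem_edgesMeeting {Λ : Finset V} {e : Sym2 V} :
    e ∈ edgesMeeting G Λ ↔ e ∈ G.edgeSet ∧ ∃ u ∈ Λ, u ∈ e := by
  classical
  simp only [edgesMeeting, Finset.mem_biUnion, mem_incidenceFinset, incidenceSet, Set.mem_ofPred_eq]
  constructor
  · rintro ⟨a, h1, h2, h3⟩; exact ⟨h2, a, h1, h3⟩
  · rintro ⟨h1, a, h2, h3⟩; exact ⟨a, h2, h1, h3⟩

/-- In an acyclic graph of minimal degree at least two every finite path can be prolonged at its
starting point; hence there are paths of every length. -/
theorem SimpleGraph.IsAcyclic.exists_isPath_length_eq [Nonempty V] (hG : G.IsAcyclic)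
    (hdeg : ∀ v, 2 ≤ G.degree v) (n : ℕ) :
    ∃ (x y : V) (p : G.Walk x y), p.IsPath ∧ p.length = n := by
  classical
  induction n with
  | zero =>
    obtain ⟨r⟩ := ‹Nonempty V›
    exact ⟨r, r, Walk.nil, by simp, by simp⟩
  | succ n ih =>
    obtain ⟨x, y, p, hp, hn⟩ := ih
    obtain ⟨v, hv, hvp⟩ : ∃ v, G.Adj v x ∧ v ∉ p.support := by
      obtain ⟨a, ha, b, hb, hne⟩ := Finset.one_lt_card.1
        (show 1 < (G.neighborFinset x).card from hdeg x)
      rw [mem_neighborFinset] at ha hb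
      cases p with
      | nil => exact ⟨a, ha.symm, by simpa using ha.symm.ne⟩
      | cons h q =>
        rw [Walk.cons_isPath_iff] at hp
        -- If both neighbours a and b of x lay on the path, they would lie on its tail, a connected
        -- set avoiding x, and x could not have two neighbours there.
        by_contra! hcon
        have ha' := hcon a ha.symm
        have hb' := hcon b hb.symm
        rw [Walk.support_cons, List.mem_cons] at ha' hb'
        have ha'' := ha'.resolve_left ha.symm.ne
        have hb'' := hb'.resolve_left hb.symm.ne
        exact hne (hG.eq_of_adj_of_adj (T := (q.support.toFinset : Set V))
          q.connected_induce_support_toFinset (by simpa using hp.2) (by simpa using ha'')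
          (by simpa using hb'') ha hb)
    exact ⟨v, y, Walk.cons hv p, by rw [Walk.cons_isPath_iff]; exact ⟨hp, hvp⟩, by simp [hn]⟩

end TreeCombinatorics

/-! ### Weights of configurations on finite subtrees -/

section Weights

open SimpleGraph

variable {V S : Type*} [AddCommGroup S] {G : SimpleGraph V} [G.LocallyFinite]

/-- The edges with both endpoints in `T`. -/
def edgesWithin (G : SimpleGraph V) [G.LocallyFinite] (T : Finset V) : Finset (Sym2 V) :=
  open Classical in (edgesMeeting G T).filter fun e => ∀ v ∈ e, v ∈ T

/-- The number of neighbours of `v` in `T`. -/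
def innerDegree (G : SimpleGraph V) [G.LocallyFinite] (T : Finset V) (v : V) : ℕ :=
  open Classical in ((G.neighborFinset v).filter (· ∈ T)).card

/-- The weight of a configuration on a finite subtree `T` of the Cayley tree of order `d`: every
edge carries its transfer weight and every missing neighbour contributes a factor `y`. -/
def treeWeight (G : SimpleGraph V) [G.LocallyFinite] (Q : S → ℝ) (hQ : Function.Even Q) (d : ℕ)
    (y : S → ℝ) (T : Finset V) (ω : V → S) : ℝ :=
  (∏ e ∈ edgesWithin G T, edgeWeight Q hQ ω e) * ∏ v ∈ T, y (ω v) ^ (d + 1 - innerDegree G T v)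

theorem innerDegree_eq_card {T F : Finset V} {v : V} (h : ∀ w, w ∈ F ↔ G.Adj v w ∧ w ∈ T) :
    innerDegree G T v = F.card := by
  classical
  rw [innerDegree]
  congr 1
  ext w
  rw [Finset.mem_filter, mem_neighborFinset, h]

theorem mk_mem_edgesWithin {T : Finset V} {a b : V} :
    s(a, b) ∈ edgesWithin G T ↔ G.Adj a b ∧ a ∈ T ∧ b ∈ T := by
  classical
  simp only [edgesWithin, Finset.mem_filter, mem_edgesMeeting, mem_edgeSet, Sym2.mem_iff,
    forall_eq_or_imp, forall_eq]
  constructor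
  · tauto
  · rintro ⟨h1, h2, h3⟩; exact ⟨⟨h1, a, h2, Or.inl rfl⟩, h2, h3⟩

theorem treeWeight_congr {Q : S → ℝ} {hQ : Function.Even Q} {d : ℕ} {y : S → ℝ} {T : Finset V}
    {ω ω' : V → S} (h : ∀ v ∈ T, ω v = ω' v) :
    treeWeight G Q hQ d y T ω = treeWeight G Q hQ d y T ω' := by
  unfold treeWeight
  congr 1
  · refine Finset.prod_congr rfl fun e he => ?_
    induction e using Sym2.ind with
    | _ a b =>
      rw [mk_mem_edgesWithin] at he
      simp [edgeWeight, h a he.2.1, h b he.2.2]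
  · exact Finset.prod_congr rfl fun v hv => by rw [h v hv]

variable [DecidableEq V]

theorem treeWeight_singleton {Q : S → ℝ} {hQ : Function.Even Q} {d : ℕ} {y : S → ℝ} (r : V)
    (ω : V → S) : treeWeight G Q hQ d y {r} ω = y (ω r) ^ (d + 1) := by
  have h1 : edgesWithin G {r} = ∅ := by
    ext e
    induction e using Sym2.ind with
    | _ a b =>
      rw [mk_mem_edgesWithin]
      simp only [Finset.mem_singleton, Finset.notMem_empty, iff_false]
      rintro ⟨h, rfl, rfl⟩
      exact h.ne rfl
  have h2 : innerDegree G {r} r = 0 := by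
    classical
    simp only [innerDegree, Finset.card_eq_zero, Finset.filter_eq_empty_iff, mem_neighborFinset,
      Finset.mem_singleton]
    intro a ha h
    exact ha.ne h.symm
  simp [treeWeight, h1, h2]

/-- The effect of adding a leaf `v` at `u`. -/
theorem treeWeight_insert (hG : G.IsAcyclic) {d : ℕ} (hreg : G.IsRegularOfDegree (d + 1))
    {Q : S → ℝ} {hQ : Function.Even Q} {y : S → ℝ} {T : Finset V}
    (hT : (G.induce (T : Set V)).Connected) {u v : V} (hu : u ∈ T) (huv : G.Adj u v) (hv : v ∉ T)
    (ω : V → S) :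
    treeWeight G Q hQ d y (insert v T) ω * y (ω u) =
      treeWeight G Q hQ d y T ω * (Q (ω u - ω v) * y (ω v) ^ d) := by
  classical
  have huniq : ∀ w ∈ T, G.Adj v w → w = u := fun w hw hvw =>
    hG.eq_of_adj_of_adj hT (by simpa using hv) (by simpa using hw) (by simpa using hu) hvw huv.symm
  have hE : edgesWithin G (insert v T) = insert s(u, v) (edgesWithin G T) := by
    ext e
    induction e using Sym2.ind with
    | _ a b =>
      rw [Finset.mem_insert, mk_mem_edgesWithin, mk_mem_edgesWithin, Sym2.eq_iff,
        Finset.mem_insert, Finset.mem_insert]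
      constructor
      · rintro ⟨hab, ha | ha, hb | hb⟩
        · exact absurd (ha.trans hb.symm) hab.ne
        · subst ha; exact Or.inl (Or.inr ⟨rfl, huniq b hb hab⟩)
        · subst hb; exact Or.inl (Or.inl ⟨huniq a ha hab.symm, rfl⟩)
        · exact Or.inr ⟨hab, ha, hb⟩
      · rintro ((⟨rfl, rfl⟩ | ⟨rfl, rfl⟩) | ⟨hab, ha, hb⟩)
        · exact ⟨huv, Or.inr hu, Or.inl rfl⟩
        · exact ⟨huv.symm, Or.inl rfl, Or.inr hu⟩
        · exact ⟨hab, Or.inr ha, Or.inr hb⟩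
  have hE' : s(u, v) ∉ edgesWithin G T := by
    rw [mk_mem_edgesWithin]; tauto
  have hdv : innerDegree G (insert v T) v = 1 := by
    rw [innerDegree_eq_card (F := {u}), Finset.card_singleton]
    intro w
    simp only [Finset.mem_insert, Finset.mem_singleton]
    constructor
    · rintro rfl; exact ⟨huv.symm, Or.inr hu⟩
    · rintro ⟨hvw, rfl | hw⟩
      · exact absurd rfl hvw.ne
      · exact huniq w hw hvw
  have hdw : ∀ w ∈ T.erase u, innerDegree G (insert v T) w = innerDegree G T w := by
    intro w hw
    rw [Finset.mem_erase] at hw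
    unfold innerDegree
    congr 1
    ext z
    simp only [Finset.mem_filter, mem_neighborFinset, Finset.mem_insert]
    constructor
    · rintro ⟨hwz, rfl | hz⟩
      · exact absurd (huniq w hw.2 hwz.symm) hw.1
      · exact ⟨hwz, hz⟩
    · rintro ⟨h1, h2⟩; exact ⟨h1, Or.inr h2⟩
  have hdu : innerDegree G (insert v T) u = innerDegree G T u + 1 := by
    rw [innerDegree_eq_card (T := T) (v := u) (F := (G.neighborFinset u).filter (· ∈ T)) (by simp),
      ← Finset.card_insert_of_notMem (a := v) (by simp [hv])]
    refine innerDegree_eq_card fun z => ?_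
    simp only [Finset.mem_filter, mem_neighborFinset, Finset.mem_insert]
    constructor
    · rintro (rfl | ⟨h1, h2⟩)
      · exact ⟨huv, Or.inl rfl⟩
      · exact ⟨h1, Or.inr h2⟩
    · rintro ⟨h1, h2 | h2⟩
      · exact Or.inl h2
      · exact Or.inr ⟨h1, h2⟩
  -- This bound keeps the natural-number subtraction in the exponent at u from truncating when u
  -- gains a neighbour.
  have hdu' : innerDegree G (insert v T) u ≤ d + 1 := by
    rw [← hreg.degree_eq u, ← card_neighborFinset_eq_degree,
      innerDegree_eq_card (F := (G.neighborFinset u).filter (· ∈ insert v T)) (by simp)]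
    exact Finset.card_filter_le _ _
  have hprod : ∏ w ∈ T.erase u, y (ω w) ^ (d + 1 - innerDegree G (insert v T) w) =
      ∏ w ∈ T.erase u, y (ω w) ^ (d + 1 - innerDegree G T w) :=
    Finset.prod_congr rfl fun w hw => by rw [hdw w hw]
  unfold treeWeight
  rw [hE, Finset.prod_insert hE', Finset.prod_insert hv, hdv, ← Finset.mul_prod_erase T _ hu,
    ← Finset.mul_prod_erase T _ hu, hdu, hprod]
  have h1 : y (ω u) ^ (d + 1 - innerDegree G T u) =
      y (ω u) ^ (d + 1 - (innerDegree G T u + 1)) * y (ω u) := by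
    rw [← pow_succ]; congr 1; omega
  rw [h1]
  simp only [edgeWeight, Sym2.lift_mk, Nat.add_sub_cancel]
  ring

/-- This identifies `treeWeight` with the formula defining a boundary law chain. A vertex of T has
all its d+1 neighbours in T ∪ ∂T and contributes no y, while acyclicity leaves a boundary vertex
exactly one neighbour there, hence the factor y^d. -/
theorem treeWeight_union_outerBoundary (hG : G.IsAcyclic) {d : ℕ}
    (hreg : G.IsRegularOfDegree (d + 1)) {Q : S → ℝ} {hQ : Function.Even Q} {y : S → ℝ}
    {T : Finset V} (hT : (G.induce (T : Set V)).Connected) (ω : V → S) :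
    treeWeight G Q hQ d y (T ∪ outerBoundary G T) ω =
      (∏ v ∈ outerBoundary G T, y (ω v) ^ d) * ∏ e ∈ edgesMeeting G T, edgeWeight Q hQ ω e := by
  classical
  have huniq : ∀ v ∉ T, ∀ u ∈ T, ∀ w ∈ T, G.Adj v w → G.Adj v u → w = u :=
    fun v hv u hu w hw hvw hvu => hG.eq_of_adj_of_adj hT (by simpa using hv) (by simpa using hw)
      (by simpa using hu) hvw hvu
  have hnb : ∀ v ∈ outerBoundary G T, ∀ w ∈ outerBoundary G T, ¬ G.Adj v w := by
    intro v hv w hw hvw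
    rw [mem_outerBoundary] at hv hw
    obtain ⟨hv, a, ha, hav⟩ := hv
    obtain ⟨hw, b, hb, hbw⟩ := hw
    -- Two adjacent boundary vertices v and w would close a cycle: w would have both v and b as
    -- neighbours in the connected set T ∪ {v}.
    have hc : (G.induce (insert v (T : Set V))).Connected := hT.induce_insert ha hav
    have := hG.eq_of_adj_of_adj hc (v := w) (u := v) (w := b)
      (by simp [hvw.ne.symm, hw]) (by simp) (by simp [hb]) hvw.symm hbw.symm
    exact hv (this ▸ hb)
  have hE : edgesWithin G (T ∪ outerBoundary G T) = edgesMeeting G T := by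
    ext e
    induction e using Sym2.ind with
    | _ a b =>
      rw [mk_mem_edgesWithin, mem_edgesMeeting, mem_edgeSet, Finset.mem_union, Finset.mem_union]
      constructor
      · rintro ⟨hab, ha | ha, hb⟩
        · exact ⟨hab, a, ha, by simp⟩
        · rcases hb with hb | hb
          · exact ⟨hab, b, hb, by simp⟩
          · exact absurd hab (hnb a ha b hb)
      · rintro ⟨hab, c, hc, hce⟩
        rw [Sym2.mem_iff] at hce
        rcases hce with rfl | rfl
        · refine ⟨hab, Or.inl hc, ?_⟩
          by_cases hb : b ∈ T
          · exact Or.inl hb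
          · exact Or.inr (mem_outerBoundary.2 ⟨hb, c, hc, hab⟩)
        · refine ⟨hab, ?_, Or.inl hc⟩
          by_cases hb : a ∈ T
          · exact Or.inl hb
          · exact Or.inr (mem_outerBoundary.2 ⟨hb, c, hc, hab.symm⟩)
  have hdT : ∀ v ∈ T, innerDegree G (T ∪ outerBoundary G T) v = d + 1 := by
    intro v hv
    rw [← hreg.degree_eq v, ← card_neighborFinset_eq_degree]
    refine innerDegree_eq_card fun w => ?_
    rw [mem_neighborFinset, Finset.mem_union, mem_outerBoundary]
    refine ⟨fun hw => ⟨hw, ?_⟩, fun hw => hw.1⟩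
    by_cases h : w ∈ T
    · exact Or.inl h
    · exact Or.inr ⟨h, v, hv, hw⟩
  have hdB : ∀ v ∈ outerBoundary G T, innerDegree G (T ∪ outerBoundary G T) v = 1 := by
    intro v hv
    obtain ⟨hvT, a, ha, hav⟩ := mem_outerBoundary.1 hv
    rw [innerDegree_eq_card (F := {a}), Finset.card_singleton]
    intro w
    simp only [Finset.mem_union, Finset.mem_singleton]
    constructor
    · rintro rfl; exact ⟨hav.symm, Or.inl ha⟩
    · rintro ⟨hvw, hw | hw⟩
      · exact huniq v hvT a ha w hw hvw hav.symm
      · exact absurd hvw (hnb v hv w hw)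
  have hdisj : Disjoint T (outerBoundary G T) := by
    rw [Finset.disjoint_right]; intro v hv; exact (mem_outerBoundary.1 hv).1
  unfold treeWeight
  rw [hE, Finset.prod_union hdisj, mul_comm]
  have h1 : ∏ v ∈ T, y (ω v) ^ (d + 1 - innerDegree G (T ∪ outerBoundary G T) v) = 1 :=
    Finset.prod_eq_one fun v hv => by rw [hdT v hv]; simp
  rw [h1, one_mul]
  congr 1
  exact Finset.prod_congr rfl fun v hv => by rw [hdB v hv]; simp

theorem SimpleGraph.Connected.induce_union_outerBoundary {T : Finset V}
    (hT : (G.induce (T : Set V)).Connected) :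
    (G.induce ((T ∪ outerBoundary G T : Finset V) : Set V)).Connected := by
  suffices H : ∀ B : Finset V, B ⊆ outerBoundary G T →
      (G.induce ((T ∪ B : Finset V) : Set V)).Connected from H _ subset_rfl
  intro B
  induction B using Finset.induction_on with
  | empty => intro _; rwa [Finset.union_empty]
  | insert v B hv ih =>
    intro hB
    obtain ⟨-, u, hu, huv⟩ := mem_outerBoundary.1 (hB (Finset.mem_insert_self v B))
    rw [Finset.union_insert, Finset.coe_insert]
    exact (ih ((Finset.subset_insert _ _).trans hB)).induce_insert (by simp [hu]) huv

end Weights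

/-! ### Marginals of boundary law chains -/

theorem MeasureTheory.hasSum_measureReal_inter_preimage_singleton {Ω β : Type*}
    [MeasurableSpace Ω] [MeasurableSpace β] [Countable β] [MeasurableSingletonClass β]
    (μ : Measure Ω) [IsFiniteMeasure μ] {A : Set Ω} (hA : MeasurableSet A) {f : Ω → β}
    (hf : Measurable f) : HasSum (fun b => μ.real (A ∩ f ⁻¹' {b})) (μ.real A) := by
  have h1 : A = ⋃ b, A ∩ f ⁻¹' {b} := by
    ext a; simp
  have hm : ∀ b, MeasurableSet (A ∩ f ⁻¹' {b}) :=
    fun b => hA.inter (hf (measurableSet_singleton b))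
  have hd : Pairwise (Function.onFun Disjoint fun b => A ∩ f ⁻¹' {b}) := by
    intro b c hbc
    rw [Function.onFun, Set.disjoint_left]
    rintro a ⟨-, h2⟩ ⟨-, h3⟩
    exact hbc (h2.symm.trans h3)
  have h2 : μ A = ∑' b, μ (A ∩ f ⁻¹' {b}) := by
    conv_lhs => rw [h1]
    exact measure_iUnion hd hm
  have h3 : ∑' b, μ (A ∩ f ⁻¹' {b}) ≠ ⊤ := h2 ▸ measure_ne_top μ A
  have h4 := ENNReal.hasSum_toReal h3
  rwa [← ENNReal.tsum_toReal_eq (fun b => measure_ne_top μ _), ← h2] at h4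

/-- Eigenfunction data of a boundary law: `∑_j Q(i-j) y(j)^d = C y(i)` with `y, C > 0`. -/
structure IsRootOfBoundaryLaw {S : Type*} [AddCommGroup S] (d : ℕ) (Q y : S → ℝ) (C : ℝ) :
    Prop where
  pos_transfer : ∀ i, 0 < Q i
  pos : ∀ i, 0 < y i
  const_pos : 0 < C
  hasSum : ∀ i, HasSum (fun j => Q (i - j) * y j ^ d) (C * y i)

/-- The transition probabilities of the Markov chain of a boundary law. -/
def transitionProb {S : Type*} [AddCommGroup S] (d : ℕ) (Q y : S → ℝ) (C : ℝ) (i j : S) : ℝ :=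
  Q (i - j) * y j ^ d / (C * y i)

theorem measurableSet_cylinder_eq {V S : Type*} [MeasurableSpace S] [MeasurableSingletonClass S]
    (T : Finset V) (ω : V → S) :
    MeasurableSet {σ : V → S | ∀ x ∈ T, σ x = ω x} := by
  have : {σ : V → S | ∀ x ∈ T, σ x = ω x} = ⋂ x ∈ T, (fun σ : V → S => σ x) ⁻¹' {ω x} := by
    ext σ; simp
  rw [this]
  exact Finset.measurableSet_biInter T fun x _ =>
    measurable_pi_apply x (measurableSet_singleton _)

theorem setOf_eq_on_union_outerBoundary {V S : Type*} [DecidableEq V] (G : SimpleGraph V)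
    [G.LocallyFinite] (Λ : Finset V) (ω : V → S) :
    {σ : V → S | (∀ x ∈ Λ, σ x = ω x) ∧ ∀ z ∈ outerBoundary G Λ, σ z = ω z} =
      {σ | ∀ x ∈ Λ ∪ outerBoundary G Λ, σ x = ω x} := by
  ext σ; simp [or_imp, forall_and]

section Chain

open SimpleGraph

variable {V S : Type*} [AddCommGroup S] {G : SimpleGraph V} [G.LocallyFinite]

namespace IsRootOfBoundaryLaw

variable {d : ℕ} {Q y : S → ℝ} {C : ℝ}

theorem transitionProb_pos (h : IsRootOfBoundaryLaw d Q y C) (i j : S) :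
    0 < transitionProb d Q y C i j :=
  div_pos (mul_pos (h.pos_transfer _) (pow_pos (h.pos _) _)) (mul_pos h.const_pos (h.pos _))

theorem hasSum_transitionProb (h : IsRootOfBoundaryLaw d Q y C) (i : S) :
    HasSum (transitionProb d Q y C i) 1 := by
  have := (h.hasSum i).div_const (C * y i)
  rwa [div_self (mul_pos h.const_pos (h.pos i)).ne'] at this

/-- Both sides equal Q(i-j) y(i)^d y(j)^d / C, which is symmetric because Q is even. -/
theorem reversible (h : IsRootOfBoundaryLaw d Q y C) (hQ : Function.Even Q) (i j : S) :
    y i ^ (d + 1) * transitionProb d Q y C i j = y j ^ (d + 1) * transitionProb d Q y C j i := by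
  have h1 := (h.pos i).ne'
  have h2 := (h.pos j).ne'
  have h3 := h.const_pos.ne'
  have h4 : Q (i - j) = Q (j - i) := by rw [← hQ (j - i), neg_sub]
  unfold transitionProb
  rw [h4]
  field_simp
  ring

end IsRootOfBoundaryLaw

/-- The root is y(i) = ∑_j Q(i-j) λ(j). The boundary law equation then reads λ = c y^d, and
substituting it back into the sum gives the eigenvalue c⁻¹. -/
theorem IsHomBoundaryLaw.exists_root {d : ℕ} {Q lam : S → ℝ} (hpos : ∀ i, 0 < Q i)
    (h : IsHomBoundaryLaw d Q lam) :
    ∃ (y : S → ℝ) (c : ℝ), 0 < c ∧ IsRootOfBoundaryLaw d Q y c⁻¹ ∧ ∀ i, lam i = c * y i ^ d := by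
  obtain ⟨c, hc, heq⟩ := h.eqn
  refine ⟨fun i => ∑' j, Q (i - j) * lam j, c, hc, ⟨hpos, fun i => ?_, inv_pos.2 hc, fun i => ?_⟩,
    heq⟩
  · exact (h.summable i).tsum_pos (fun j => (mul_pos (hpos _) (h.pos _)).le) i
      (mul_pos (hpos _) (h.pos _))
  · have h1 := (h.summable i).hasSum.mul_left c⁻¹
    refine h1.congr_fun fun j => ?_
    rw [heq j]
    field_simp

variable [MeasurableSpace S]

/-- The marginal of `μ` on `T` is proportional to the weight of configurations on `T`. -/
def HasTreeMarginal (G : SimpleGraph V) [G.LocallyFinite] (Q : S → ℝ) (hQ : Function.Even Q)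
    (d : ℕ) (y : S → ℝ) (μ : Measure (V → S)) (T : Finset V) : Prop :=
  ∃ K : ℝ, 0 < K ∧ ∀ ω : V → S, μ.real {σ | ∀ x ∈ T, σ x = ω x} = K * treeWeight G Q hQ d y T ω

variable [DecidableEq V] {d : ℕ} {Q y lam : S → ℝ} {hQ : Function.Even Q} {C c : ℝ}

theorem IsBoundaryLawChain.of_hasTreeMarginal (hG : G.IsAcyclic)
    (hreg : G.IsRegularOfDegree (d + 1)) (hc : 0 < c)
    (hlam : ∀ i, lam i = c * y i ^ d) {μ : Measure (V → S)} [IsProbabilityMeasure μ]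
    (h : ∀ T : Finset V, (G.induce (T : Set V)).Connected → HasTreeMarginal G Q hQ d y μ T) :
    IsBoundaryLawChain G Q hQ lam μ := by
  refine ⟨inferInstance, fun T hT => ?_⟩
  obtain ⟨K, hK, h⟩ := h _ hT.induce_union_outerBoundary
  -- The constant K of the weight formula is 1/Z up to the factors c, one for each boundary vertex,
  -- by which λ and y^d differ.
  refine ⟨K⁻¹ * c ^ (outerBoundary G T).card, mul_pos (inv_pos.2 hK) (pow_pos hc _), fun ω => ?_⟩
  rw [setOf_eq_on_union_outerBoundary, h, treeWeight_union_outerBoundary hG hreg hT]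
  simp only [hlam, Finset.prod_mul_distrib, Finset.prod_const]
  field_simp

variable [Countable S] [MeasurableSingletonClass S]

/-- Summing over the state j of the leaf v replaces Q(ω_u - j) y(j)^d by C y(ω_u), which restores
the factor y at u for the neighbour now missing. The constant K C is kept explicit because the
Markov property compares the two marginals. -/
theorem HasTreeMarginal.of_insert_aux (hG : G.IsAcyclic) (hreg : G.IsRegularOfDegree (d + 1))
    (hy : IsRootOfBoundaryLaw d Q y C) {μ : Measure (V → S)} [IsProbabilityMeasure μ]
    {T : Finset V} (hT : (G.induce (T : Set V)).Connected) {u v : V} (hu : u ∈ T)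
    (huv : G.Adj u v) (hv : v ∉ T) {K : ℝ}
    (h : ∀ ω : V → S, μ.real {σ | ∀ x ∈ insert v T, σ x = ω x} =
      K * treeWeight G Q hQ d y (insert v T) ω) (ω : V → S) :
    μ.real {σ | ∀ x ∈ T, σ x = ω x} = K * C * treeWeight G Q hQ d y T ω := by
  have h1 := hasSum_measureReal_inter_preimage_singleton μ (measurableSet_cylinder_eq T ω)
    (measurable_pi_apply v)
  have h2 : ∀ j, μ.real ({σ : V → S | ∀ x ∈ T, σ x = ω x} ∩ (fun σ => σ v) ⁻¹' {j}) =
      K * treeWeight G Q hQ d y T ω / y (ω u) * (Q (ω u - j) * y j ^ d) := by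
    intro j
    have hupd : ∀ x ∈ T, Function.update ω v j x = ω x := fun x hx =>
      Function.update_of_ne (fun h => hv (h.subst hx)) _ _
    have h3 : {σ : V → S | ∀ x ∈ T, σ x = ω x} ∩ (fun σ => σ v) ⁻¹' {j} =
        {σ | ∀ x ∈ insert v T, σ x = Function.update ω v j x} := by
      ext σ
      simp only [Set.mem_inter_iff, Set.mem_ofPred_eq, Set.mem_preimage, Set.mem_singleton_iff,
        Finset.forall_mem_insert, Function.update_self]
      rw [and_comm]
      exact and_congr_right fun _ => forall₂_congr fun x hx => by rw [hupd x hx]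
    have h4 := treeWeight_insert hG hreg (Q := Q) (hQ := hQ) (y := y) hT hu huv hv
      (Function.update ω v j)
    rw [hupd u hu, Function.update_self, treeWeight_congr hupd] at h4
    rw [h3, h, div_mul_eq_mul_div, eq_div_iff (hy.pos _).ne', mul_assoc, h4]
    ring
  rw [funext h2] at h1
  rw [h1.unique ((hy.hasSum (ω u)).mul_left _)]
  have := (hy.pos (ω u)).ne'
  field_simp

theorem HasTreeMarginal.of_insert (hG : G.IsAcyclic) (hreg : G.IsRegularOfDegree (d + 1))
    (hy : IsRootOfBoundaryLaw d Q y C) {μ : Measure (V → S)} [IsProbabilityMeasure μ]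
    {T : Finset V} (hT : (G.induce (T : Set V)).Connected) {u v : V} (hu : u ∈ T)
    (huv : G.Adj u v) (hv : v ∉ T) (h : HasTreeMarginal G Q hQ d y μ (insert v T)) :
    HasTreeMarginal G Q hQ d y μ T := by
  obtain ⟨K, hK, h⟩ := h
  exact ⟨K * C, mul_pos hK hy.const_pos, of_insert_aux hG hreg hy hT hu huv hv h⟩

/-- The Markov property for the addition of a single leaf. -/
theorem HasTreeMarginal.measureReal_insert (hG : G.IsAcyclic) (hreg : G.IsRegularOfDegree (d + 1))
    (hy : IsRootOfBoundaryLaw d Q y C) {μ : Measure (V → S)} [IsProbabilityMeasure μ]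
    {T : Finset V} (hT : (G.induce (T : Set V)).Connected) {u v : V} (hu : u ∈ T)
    (huv : G.Adj u v) (hv : v ∉ T) (h : HasTreeMarginal G Q hQ d y μ (insert v T)) (ω : V → S) :
    μ.real {σ | ∀ x ∈ insert v T, σ x = ω x} =
      μ.real {σ | ∀ x ∈ T, σ x = ω x} * transitionProb d Q y C (ω u) (ω v) := by
  obtain ⟨K, hK, h⟩ := h
  rw [of_insert_aux hG hreg hy hT hu huv hv h, h, transitionProb]
  have h4 := treeWeight_insert hG hreg (Q := Q) (hQ := hQ) (y := y) hT hu huv hv ω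
  have h5 := (hy.pos (ω u)).ne'
  have h6 := hy.const_pos.ne'
  field_simp
  rw [h4]
  ring

theorem HasTreeMarginal.mono (hG : G.IsAcyclic) (hreg : G.IsRegularOfDegree (d + 1))
    (hy : IsRootOfBoundaryLaw d Q y C) {μ : Measure (V → S)} [IsProbabilityMeasure μ]
    {T T' : Finset V} (hT : (G.induce (T : Set V)).Connected)
    (hT' : (G.induce (T' : Set V)).Connected) (hsub : T ⊆ T')
    (h : HasTreeMarginal G Q hQ d y μ T') : HasTreeMarginal G Q hQ d y μ T := by
  refine hT.growth_induction hT' hsub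
    (motive := fun U => HasTreeMarginal G Q hQ d y μ U → HasTreeMarginal G Q hQ d y μ T)
    id (fun U u v hU _ hu huv hv _ ih hUv => ih ?_) h
  exact hUv.of_insert hG hreg hy hU hu huv hv

/-- The definition of the chain prescribes marginals only on sets of the form T ∪ ∂T; removing the
boundary leaf by leaf reaches T itself. -/
theorem IsBoundaryLawChain.hasTreeMarginal (hG : G.IsAcyclic)
    (hreg : G.IsRegularOfDegree (d + 1)) (hy : IsRootOfBoundaryLaw d Q y C) (hc : 0 < c)
    (hlam : ∀ i, lam i = c * y i ^ d) {μ : Measure (V → S)}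
    (h : IsBoundaryLawChain G Q hQ lam μ) {T : Finset V}
    (hT : (G.induce (T : Set V)).Connected) : HasTreeMarginal G Q hQ d y μ T := by
  have := h.prob
  refine HasTreeMarginal.mono hG hreg hy hT hT.induce_union_outerBoundary
    Finset.subset_union_left ?_
  obtain ⟨Z, hZ, h⟩ := h.marginal T hT
  refine ⟨Z⁻¹ * c ^ (outerBoundary G T).card, mul_pos (inv_pos.2 hZ) (pow_pos hc _), fun ω => ?_⟩
  rw [← setOf_eq_on_union_outerBoundary, h, treeWeight_union_outerBoundary hG hreg hT]
  simp only [hlam, Finset.prod_mul_distrib, Finset.prod_const]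
  ring

end Chain

/-- Non-negative weights of total mass one on a countable space define a probability measure. -/
theorem exists_isProbabilityMeasure_of_hasSum {S : Type*} [MeasurableSpace S]
    [MeasurableSingletonClass S] {f : S → ℝ} (hf : ∀ i, 0 ≤ f i) (hs : HasSum f 1) :
    ∃ m : Measure S, IsProbabilityMeasure m ∧ ∀ i, m {i} = ENNReal.ofReal (f i) := by
  have h1 : ∑' i, ENNReal.ofReal (f i) = 1 := by
    rw [← ENNReal.ofReal_tsum_of_nonneg hf hs.summable, hs.tsum_eq, ENNReal.ofReal_one]
  let p : PMF S := ⟨fun i => ENNReal.ofReal (f i), h1 ▸ ENNReal.summable.hasSum⟩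
  exact ⟨p.toMeasure, inferInstance,
    fun i => p.toMeasure_apply_singleton i (measurableSet_singleton i)⟩

/-! ### Construction of the chain from a root -/

section Existence

open SimpleGraph

variable {V S : Type*} [AddCommGroup S] {G : SimpleGraph V}

/-- The parent of a vertex attached to a connected set containing the root is its neighbour in that
set. -/
theorem SimpleGraph.IsAcyclic.eq_of_adj_of_dist_lt (hG : G.IsAcyclic) (hc : G.Connected)
    {r u v w : V} {U : Set V} (hU : (G.induce U).Connected) (hr : r ∈ U) (hu : u ∈ U)
    (hv : v ∉ U) (huv : G.Adj u v) (hwv : G.Adj w v) (hd : G.dist w r < G.dist v r) :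
    w = u := by
  classical
  obtain ⟨p, hp⟩ := hc.exists_walk_length_eq_dist w r
  -- A geodesic from w to the root cannot visit v, which is farther from the root than w. It can
  -- thus be joined to U without v, and v would have both u and w as neighbours in a connected set.
  have hvp : v ∉ p.support := by
    intro h
    have h1 := dist_le (p.dropUntil v h)
    have h2 := p.length_dropUntil_le_length h
    omega
  have h1 : (G.induce (U ∪ {a | a ∈ p.support})).Connected :=
    induce_union_connected hU.preconnected p.connected_induce_support.preconnected
      ⟨r, hr, p.end_mem_support⟩
  exact hG.eq_of_adj_of_adj h1 (v := v) (by simp [hv, hvp]) (Or.inr p.start_mem_support)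
    (Or.inl hu) hwv.symm huv.symm

/-- The field obtained from independent choices `U (v, s)` of the state of `v` given that its
parent has the state `s`. -/
def recursiveField (par : V → V) (U : V × S → S) : ℕ → V → S
  -- The root has no parent; 0 is a dummy index there.
  | 0, v => U (v, 0)
  | n + 1, v => U (v, recursiveField par U n (par v))

theorem measurable_recursiveField [MeasurableSpace S] [Countable S] [MeasurableSingletonClass S]
    (par : V → V) (n : ℕ) (v : V) :
    Measurable fun U : V × S → S => recursiveField par U n v := by
  induction n generalizing v with
  | zero => exact measurable_pi_apply _
  | succ n ih =>
    have h1 : Measurable fun z : (V × S → S) × S => z.1 (v, z.2) :=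
      measurable_from_prod_countable_left fun s => measurable_pi_apply (v, s)
    exact h1.comp (measurable_id.prodMk (ih (par v)))

variable [G.LocallyFinite] [MeasurableSpace S] [Countable S] [MeasurableSingletonClass S]

/-- Existence of the tree-indexed Markov chain of a normalisable boundary law. -/
theorem IsRootOfBoundaryLaw.exists_isBoundaryLawChain (hG : G.IsTree) {d : ℕ}
    (hreg : G.IsRegularOfDegree (d + 1)) {Q y lam : S → ℝ} (hQ : Function.Even Q) {C c : ℝ}
    (hy : IsRootOfBoundaryLaw d Q y C) (hsum : Summable fun i => y i ^ (d + 1)) (hc : 0 < c)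
    (hlam : ∀ i, lam i = c * y i ^ d) :
    ∃ μ : Measure (V → S), IsBoundaryLawChain G Q hQ lam μ := by
  classical
  obtain ⟨r⟩ := hG.1.nonempty
  -- The parent is the first step of a geodesic to the root; its value at the root itself is
  -- irrelevant.
  have hpar : ∀ v, ∃ u, v ≠ r → G.Adj u v ∧ G.dist v r = G.dist u r + 1 := by
    intro v
    by_cases hv : v = r
    · exact ⟨v, fun h => absurd hv h⟩
    obtain ⟨p, hp⟩ := hG.1.exists_walk_length_eq_dist v r
    cases p with
    | nil => exact absurd rfl hv
    | @cons _ u _ h q =>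
      refine ⟨u, fun _ => ⟨h.symm, ?_⟩⟩
      have h1 := dist_le q
      rw [Walk.length_cons] at hp
      have h2 : G.dist v r ≤ G.dist v u + G.dist u r := hG.1.dist_triangle
      rw [dist_eq_one_iff_adj.2 h] at h2
      omega
  choose par hpar using hpar
  set N := ∑' i, y i ^ (d + 1) with hN
  have hNpos : 0 < N :=
    hsum.tsum_pos (fun i => (pow_pos (hy.pos i) _).le) 0 (pow_pos (hy.pos 0) _)
  obtain ⟨m0, hm0, hm0'⟩ := exists_isProbabilityMeasure_of_hasSum
    (f := fun i => y i ^ (d + 1) / N) (fun i => (div_pos (pow_pos (hy.pos i) _) hNpos).le)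
    (by have := hsum.hasSum.div_const N; rwa [← hN, div_self hNpos.ne'] at this)
  choose m hm hm' using fun i => exists_isProbabilityMeasure_of_hasSum
    (fun j => (hy.transitionProb_pos i j).le) (hy.hasSum_transitionProb i)
  -- The root is sampled from the normalized y^(d+1). Every other vertex gets one independent sample
  -- for each possible state s of its parent, with law P(s,·), and the recursion picks the relevant
  -- one.
  let M : V × S → Measure S := fun vs => if vs.1 = r then m0 else m vs.2
  have hM : ∀ vs, IsProbabilityMeasure (M vs) := by
    intro vs; simp only [M]; split_ifs <;> infer_instance
  let σ : (V × S → S) → V → S := fun U v => recursiveField par U (G.dist v r) v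
  have hσ : Measurable σ := measurable_pi_lambda _ fun v => measurable_recursiveField par _ v
  let pred : (V → S) → V → S := fun ω v => if v = r then 0 else ω (par v)
  have hσrec : ∀ U v, σ U v = U (v, pred (σ U) v) := by
    intro U v
    by_cases hv : v = r
    · simp [σ, pred, hv, recursiveField]
    · simp only [σ, pred, if_neg hv]
      rw [(hpar v hv).2, recursiveField]
  let g : (V → S) → V → ℝ := fun ω v =>
    if v = r then y (ω v) ^ (d + 1) / N else transitionProb d Q y C (ω (par v)) (ω v)
  have hg : ∀ ω v, M (v, pred ω v) {ω v} = ENNReal.ofReal (g ω v) := by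
    intro ω v
    by_cases hv : v = r
    · simp only [M, g, if_pos hv, hm0']
    · simp only [M, g, if_neg hv, hm', pred]
  have hgpos : ∀ ω v, 0 ≤ g ω v := by
    intro ω v
    simp only [g]
    split_ifs
    · exact (div_pos (pow_pos (hy.pos _) _) hNpos).le
    · exact (hy.transitionProb_pos _ _).le
  let μ : Measure (V → S) := (Measure.infinitePi M).map σ
  have hμ : IsProbabilityMeasure μ := Measure.isProbabilityMeasure_map hσ.aemeasurable
  -- On a set closed under taking parents, prescribing ω amounts to prescribing the sample with
  -- index (v, ω of the parent) for each v. These indices are distinct, so the probability is a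
  -- product.
  have hcyl : ∀ T : Finset V, (∀ w ∈ T, w ≠ r → par w ∈ T) → ∀ ω : V → S,
      μ.real {s | ∀ x ∈ T, s x = ω x} = ∏ v ∈ T, g ω v := by
    intro T hT ω
    have h1 : σ ⁻¹' {s | ∀ x ∈ T, s x = ω x} =
        Set.pi (T.image fun v => (v, pred ω v)) fun vs => {ω vs.1} := by
      ext U
      simp only [Set.mem_preimage, Set.mem_ofPred_eq, Set.mem_pi, Finset.coe_image, Set.mem_image,
        Finset.mem_coe, forall_exists_index, and_imp, forall_apply_eq_imp_iff₂,
        Set.mem_singleton_iff]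
      have hpred : ∀ x ∈ T, (x ≠ r → σ U (par x) = ω (par x)) → pred (σ U) x = pred ω x := by
        intro x hx h
        by_cases hxr : x = r
        · simp [pred, hxr]
        · simp [pred, hxr, h hxr]
      constructor
      · intro h x hx
        rw [← h x hx, hσrec, hpred x hx fun hxr => h _ (hT x hx hxr)]
      · intro h
        have : ∀ n, ∀ x ∈ T, G.dist x r = n → σ U x = ω x := by
          intro n
          induction n with
          | zero =>
            intro x hx hn
            rw [hσrec, hpred x hx fun hxr => ?_, h x hx]
            exact absurd (hG.1.dist_eq_zero_iff.1 hn) hxr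
          | succ n ih =>
            intro x hx hn
            rw [hσrec, hpred x hx fun hxr => ih _ (hT x hx hxr) ?_, h x hx]
            have := (hpar x hxr).2
            omega
        exact fun x hx => this _ x hx rfl
    rw [measureReal_def, Measure.map_apply hσ (measurableSet_cylinder_eq T ω), h1,
      Measure.infinitePi_pi _ fun _ _ => measurableSet_singleton _,
      Finset.prod_image fun a _ b _ hab => (Prod.mk.inj hab).1]
    simp only [hg]
    rw [← ENNReal.ofReal_prod_of_nonneg fun v _ => hgpos ω v,
      ENNReal.toReal_ofReal (Finset.prod_nonneg fun v _ => hgpos ω v)]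
  have hroot : ∀ T : Finset V, (G.induce (T : Set V)).Connected → r ∈ T →
      HasTreeMarginal G Q hQ d y μ T := by
    intro T hT hr
    have key : (∀ w ∈ T, w ≠ r → par w ∈ T) ∧
        ∃ K : ℝ, 0 < K ∧ ∀ ω : V → S, ∏ v ∈ T, g ω v = K * treeWeight G Q hQ d y T ω := by
      refine Connected.growth_induction (T := {r})
        (motive := fun T => (∀ w ∈ T, w ≠ r → par w ∈ T) ∧
          ∃ K : ℝ, 0 < K ∧ ∀ ω : V → S, ∏ v ∈ T, g ω v = K * treeWeight G Q hQ d y T ω)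
        (by rw [Finset.coe_singleton]; exact connected_induce_singleton r) hT (by simpa using hr)
        ⟨fun w hw hwr => absurd (Finset.mem_singleton.1 hw) hwr, N⁻¹, inv_pos.2 hNpos,
          fun ω => ?_⟩ ?_
      · rw [treeWeight_singleton, Finset.prod_singleton]
        simp only [g, if_true]
        ring
      · rintro U u v hU hrU hu huv hv - ⟨hcl, K, hK, hprod⟩
        rw [Finset.singleton_subset_iff] at hrU
        have hvr : v ≠ r := fun h => hv (h ▸ hrU)
        have hpv : par v = u := hG.isAcyclic.eq_of_adj_of_dist_lt hG.1 hU hrU hu hv huv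
          (hpar v hvr).1 (by rw [(hpar v hvr).2]; exact Nat.lt_succ_self _)
        refine ⟨fun w hw hwr => ?_, K * C⁻¹, mul_pos hK (inv_pos.2 hy.const_pos), fun ω => ?_⟩
        · rw [Finset.mem_insert] at hw ⊢
          rcases hw with rfl | hw
          · exact Or.inr (hpv ▸ hu)
          · exact Or.inr (hcl w hw hwr)
        · have h4 := treeWeight_insert hG.isAcyclic hreg (Q := Q) (hQ := hQ) (y := y)
            hU hu huv hv ω
          rw [Finset.prod_insert hv, hprod]
          simp only [g, if_neg hvr, hpv, transitionProb]
          have h5 := (hy.pos (ω u)).ne'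
          have h6 := hy.const_pos.ne'
          field_simp
          linarith
    obtain ⟨hcl, K, hK, hprod⟩ := key
    exact ⟨K, hK, fun ω => by rw [hcyl T hcl, hprod]⟩
  refine ⟨μ, IsBoundaryLawChain.of_hasTreeMarginal hG.isAcyclic hreg hc hlam fun T hT => ?_⟩
  -- A subtree that misses the root is joined to it by a walk; the enlarged marginal is then
  -- restricted to T.
  obtain ⟨⟨t, ht⟩⟩ := hT.nonempty
  obtain ⟨p⟩ := hG.1.preconnected t r
  have hT' : (G.induce ((T ∪ p.support.toFinset : Finset V) : Set V)).Connected := by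
    rw [Finset.coe_union]
    exact induce_union_connected hT.preconnected
      p.connected_induce_support_toFinset.preconnected ⟨t, ht, by simp⟩
  exact (hroot _ hT' (by simp)).mono hG.isAcyclic hreg hy hT hT' Finset.subset_union_left

end Existence

/-! ### Convergence to equilibrium on a countable state space -/

section MarkovConvergence

variable {S : Type*}

theorem Summable.mul_bounded {p f : S → ℝ} {M : ℝ} (hp : Summable p) (hp0 : ∀ i, 0 ≤ p i)
    (hf : ∀ i, |f i| ≤ M) : Summable fun i => p i * f i := by
  refine Summable.of_norm_bounded (hp.mul_right M) fun i => ?_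
  rw [Real.norm_eq_abs, abs_mul, abs_of_nonneg (hp0 i)]
  exact mul_le_mul_of_nonneg_left (hf i) (hp0 i)

/-- The action of a transition matrix on functions. -/
def markovApply (P : S → S → ℝ) (f : S → ℝ) (i : S) : ℝ := ∑' j, P i j * f j

variable {P : S → S → ℝ} {α : S → ℝ}

theorem abs_markovApply_le (hP : ∀ i j, 0 ≤ P i j) (hP1 : ∀ i, HasSum (P i) 1) {f : S → ℝ} {M : ℝ}
    (hf : ∀ i, |f i| ≤ M) (i : S) : |markovApply P f i| ≤ M := by
  have h1 := (hP1 i).summable.mul_bounded (hP i) hf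
  have h2 : ∑' j, ‖P i j * f j‖ ≤ ∑' j, P i j * M := by
    refine h1.norm.tsum_le_tsum (fun j => ?_) ((hP1 i).summable.mul_right M)
    rw [Real.norm_eq_abs, abs_mul, abs_of_nonneg (hP i j)]
    exact mul_le_mul_of_nonneg_left (hf j) (hP i j)
  rw [tsum_mul_right, (hP1 i).tsum_eq, one_mul] at h2
  exact (norm_tsum_le_tsum_norm h1.norm).trans h2

/-- Averages of bounded functions with respect to a stationary law are invariant. -/
theorem tsum_mul_markovApply (hP : ∀ i j, 0 ≤ P i j) (hP1 : ∀ i, HasSum (P i) 1)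
    (hα : ∀ i, 0 ≤ α i) (hαs : Summable α) (hst : ∀ j, HasSum (fun i => α i * P i j) (α j))
    {f : S → ℝ} {M : ℝ} (hf : ∀ i, |f i| ≤ M) :
    ∑' i, α i * markovApply P f i = ∑' j, α j * f j := by
  have hnn : 0 ≤ fun z : S × S => α z.1 * P z.1 z.2 := fun z => mul_nonneg (hα z.1) (hP z.1 z.2)
  have h0 : Summable fun z : S × S => α z.1 * P z.1 z.2 := by
    rw [summable_prod_of_nonneg hnn]
    constructor
    · intro i
      exact (hP1 i).summable.mul_left (α i)
    · refine hαs.congr fun i => ?_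
      simp only [tsum_mul_left, (hP1 i).tsum_eq, mul_one]
  have h1 : Summable fun z : S × S => α z.1 * P z.1 z.2 * f z.2 := by
    have hfz : ∀ z : S × S, |f z.2| ≤ M := fun z => hf z.2
    exact Summable.mul_bounded h0 (fun z => hnn z) hfz
  have h2 : Summable (Function.uncurry fun i j => α i * P i j * f j) := h1
  calc ∑' i, α i * markovApply P f i = ∑' i, ∑' j, α i * P i j * f j := by
        refine tsum_congr fun i => ?_
        rw [markovApply, ← tsum_mul_left]
        exact tsum_congr fun j => (mul_assoc _ _ _).symm
    _ = ∑' j, ∑' i, α i * P i j * f j := h2.tsum_comm.symm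
    _ = ∑' j, α j * f j := tsum_congr fun j => by rw [tsum_mul_right, (hst j).tsum_eq]

/-- Convergence to equilibrium of a Markov chain with strictly positive transition probabilities
and a stationary law on a countable space. -/
theorem tendsto_iterate_markovApply (hP : ∀ i j, 0 < P i j) (hP1 : ∀ i, HasSum (P i) 1)
    (hα : ∀ i, 0 < α i) (hα1 : HasSum α 1) (hst : ∀ j, HasSum (fun i => α i * P i j) (α j))
    {f : S → ℝ} {M : ℝ} (hf : ∀ i, |f i| ≤ M) (i : S) :
    Tendsto (fun n => (markovApply P)^[n] f i) atTop (𝓝 (∑' j, α j * f j)) := by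
  have hP' : ∀ i j, 0 ≤ P i j := fun i j => (hP i j).le
  have hα' : ∀ i, 0 ≤ α i := fun i => (hα i).le
  set F : ℕ → S → ℝ := fun n => (markovApply P)^[n] f with hF
  have hFs : ∀ n, F (n + 1) = markovApply P (F n) := fun n => Function.iterate_succ_apply' _ _ _
  have hFM : ∀ n i, |F n i| ≤ M := by
    intro n
    induction n with
    | zero => exact hf
    | succ n ih => intro i; rw [hFs]; exact abs_markovApply_le hP' hP1 ih i
  have hFM2 : ∀ n i, |F n i ^ 2| ≤ M ^ 2 := by
    intro n i
    rw [abs_pow]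
    exact pow_le_pow_left₀ (abs_nonneg _) (hFM n i) 2
  have hmean : ∀ n, ∑' j, α j * F n j = ∑' j, α j * f j := by
    intro n
    induction n with
    | zero => rfl
    | succ n ih => rw [hFs, tsum_mul_markovApply hP' hP1 hα' hα1.summable hst (hFM n), ih]
  -- The second moment of P^n f under α serves as a Lyapunov function. It decreases by the α-mean of
  -- the conditional variances of P^n f, so these variances tend to zero.
  set D : ℕ → ℝ := fun n => ∑' j, α j * F n j ^ 2 with hD
  have hDs : ∀ n, Summable fun j => α j * F n j ^ 2 := fun n =>
    hα1.summable.mul_bounded hα' (hFM2 n)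
  have hvar : ∀ n i l, P i l * (F n l - F (n + 1) i) ^ 2 ≤
      markovApply P (fun j => F n j ^ 2) i - F (n + 1) i ^ 2 := by
    intro n i l
    set a := F (n + 1) i with ha
    have h1 := ((hP1 i).summable.mul_bounded (hP' i) (hFM2 n)).hasSum
    have h2 := ((hP1 i).summable.mul_bounded (hP' i) (hFM n)).hasSum
    have h3 : HasSum (fun j => P i j * (F n j - a) ^ 2)
        (markovApply P (fun j => F n j ^ 2) i - 2 * a * a + a ^ 2 * 1) := by
      have h4 := (h1.sub (h2.mul_left (2 * a))).add ((hP1 i).mul_left (a ^ 2))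
      have h5 : ∑' j, P i j * F n j = a := by rw [ha, hFs, markovApply]
      rw [h5] at h4
      exact h4.congr_fun fun j => by ring
    have h6 := le_hasSum h3 l fun j _ => mul_nonneg (hP' i j) (sq_nonneg _)
    linarith
  have hstep : ∀ n i l, α i * (P i l * (F n l - F (n + 1) i) ^ 2) ≤ D n - D (n + 1) := by
    intro n i l
    have h1 := tsum_mul_markovApply hP' hP1 hα' hα1.summable hst (hFM2 n)
    have h2 : Summable fun i => α i * markovApply P (fun j => F n j ^ 2) i :=
      hα1.summable.mul_bounded hα' (abs_markovApply_le hP' hP1 (hFM2 n))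
    have h3 := h2.hasSum.sub (hDs (n + 1)).hasSum
    rw [h1] at h3
    have h4 := le_hasSum h3 i fun j _ => by
      have := (mul_nonneg (hP' j j) (sq_nonneg _)).trans (hvar n j j)
      have := mul_nonneg (hα' j) this
      rwa [mul_sub] at this
    refine le_trans ?_ h4
    rw [← mul_sub]
    exact mul_le_mul_of_nonneg_left (hvar n i l) (hα' i)
  have hanti : Antitone D := antitone_nat_of_succ_le fun n => by
    have := hstep n i i
    have h2 := mul_nonneg (hα' i) (mul_nonneg (hP' i i) (sq_nonneg (F n i - F (n + 1) i)))
    linarith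
  have hbdd : BddBelow (Set.range D) :=
    ⟨0, by rintro _ ⟨n, rfl⟩; exact tsum_nonneg fun j => mul_nonneg (hα' j) (sq_nonneg _)⟩
  have hDlim := tendsto_atTop_ciInf hanti hbdd
  have hdiff : Tendsto (fun n => D n - D (n + 1)) atTop (𝓝 0) := by
    simpa using hDlim.sub (hDlim.comp (tendsto_add_atTop_nat 1))
  -- As α(i) P(i,l) > 0 for every pair, vanishing variance forces P^(n+1) f(i) and P^n f(l) together
  -- for every l, with no separate aperiodicity argument. Averaging over l against α then replaces
  -- P^n f(l) by the invariant mean.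
  have hlim : ∀ l, Tendsto (fun n => F (n + 1) i - F n l) atTop (𝓝 0) := by
    intro l
    have hc : 0 < α i * P i l := mul_pos (hα i) (hP i l)
    have h1 : Tendsto (fun n => (F (n + 1) i - F n l) ^ 2) atTop (𝓝 0) := by
      refine squeeze_zero (g := fun n => (α i * P i l)⁻¹ * (D n - D (n + 1)))
        (fun n => sq_nonneg _) (fun n => ?_) (by simpa using hdiff.const_mul (α i * P i l)⁻¹)
      rw [inv_mul_eq_div, le_div_iff₀ hc]
      have := hstep n i l
      linarith [this, sq_nonneg (F n l - F (n + 1) i), (by ring :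
        (F (n + 1) i - F n l) ^ 2 * (α i * P i l) =
          α i * (P i l * (F n l - F (n + 1) i) ^ 2))]
    have h2 := h1.sqrt
    rw [Real.sqrt_zero] at h2
    simp only [Real.sqrt_sq_eq_abs] at h2
    exact (tendsto_zero_iff_abs_tendsto_zero _).2 h2
  have h1 : Tendsto (fun n => ∑' l, α l * (F (n + 1) i - F n l)) atTop (𝓝 (∑' l : S, 0)) := by
    refine tendsto_tsum_of_dominated_convergence (bound := fun l => α l * (M + M))
      (hα1.summable.mul_right _) (fun l => by simpa using (hlim l).const_mul (α l))
      (Eventually.of_forall fun n l => ?_)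
    rw [Real.norm_eq_abs, abs_mul, abs_of_nonneg (hα' l)]
    exact mul_le_mul_of_nonneg_left
      ((norm_sub_le (F (n + 1) i) (F n l)).trans (add_le_add (hFM _ _) (hFM _ _))) (hα' l)
  have h2 : ∀ n, ∑' l, α l * (F (n + 1) i - F n l) = F (n + 1) i - ∑' j, α j * f j := by
    intro n
    have h3 := (hα1.summable.mul_bounded hα' (hFM n)).hasSum
    rw [hmean] at h3
    have h4 := (hα1.mul_right (F (n + 1) i)).sub h3
    rw [one_mul] at h4
    rw [← h4.tsum_eq]
    exact tsum_congr fun l => by ring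
  rw [tsum_zero] at h1
  simp only [h2] at h1
  have h3 := h1.add_const (∑' j, α j * f j)
  simp only [sub_add_cancel, zero_add] at h3
  exact (tendsto_add_atTop_iff_nat 1).1 h3

end MarkovConvergence

/-- The invariant distribution of the Markov chain of a normalisable boundary law. -/
def invariantLaw {S : Type*} (d : ℕ) (y : S → ℝ) (i : S) : ℝ :=
  y i ^ (d + 1) / ∑' l, y l ^ (d + 1)

/-! ### Joint law at the ends of a path -/

section TwoPoint

open SimpleGraph

variable {V S : Type*} [AddCommGroup S] {d : ℕ} {Q y : S → ℝ} {C : ℝ}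

namespace IsRootOfBoundaryLaw

theorem normalization_pos (hy : IsRootOfBoundaryLaw d Q y C)
    (hsum : Summable fun i => y i ^ (d + 1)) : 0 < ∑' l, y l ^ (d + 1) :=
  hsum.tsum_pos (fun i => (pow_pos (hy.pos i) _).le) 0 (pow_pos (hy.pos 0) _)

theorem invariantLaw_pos (hy : IsRootOfBoundaryLaw d Q y C)
    (hsum : Summable fun i => y i ^ (d + 1)) (i : S) : 0 < invariantLaw d y i :=
  div_pos (pow_pos (hy.pos i) _) (hy.normalization_pos hsum)

theorem hasSum_invariantLaw (hy : IsRootOfBoundaryLaw d Q y C)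
    (hsum : Summable fun i => y i ^ (d + 1)) : HasSum (invariantLaw d y) 1 := by
  have := hsum.hasSum.div_const (∑' l, y l ^ (d + 1))
  rwa [div_self (hy.normalization_pos hsum).ne'] at this

theorem invariantLaw_mul_transitionProb (hy : IsRootOfBoundaryLaw d Q y C)
    (hQ : Function.Even Q) (i j : S) :
    invariantLaw d y i * transitionProb d Q y C i j =
      invariantLaw d y j * transitionProb d Q y C j i := by
  unfold invariantLaw
  rw [div_mul_eq_mul_div, hy.reversible hQ i j, div_mul_eq_mul_div]

theorem hasSum_invariantLaw_mul_transitionProb (hy : IsRootOfBoundaryLaw d Q y C)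
    (hQ : Function.Even Q) (j : S) :
    HasSum (fun i => invariantLaw d y i * transitionProb d Q y C i j) (invariantLaw d y j) := by
  have h1 := (hy.hasSum_transitionProb j).mul_left (invariantLaw d y j)
  rw [mul_one] at h1
  exact h1.congr_fun fun i => hy.invariantLaw_mul_transitionProb hQ i j

end IsRootOfBoundaryLaw

variable {G : SimpleGraph V} [G.LocallyFinite] [MeasurableSpace S] [Countable S]
  [MeasurableSingletonClass S] {hQ : Function.Even Q}

/-- A single vertex has weight y^(d+1), and total mass one determines the constant. -/
theorem measureReal_site [DecidableEq V] {μ : Measure (V → S)} [IsProbabilityMeasure μ] {x : V}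
    (h : HasTreeMarginal G Q hQ d y μ {x}) (i : S) :
    μ.real {σ | σ x = i} = invariantLaw d y i := by
  obtain ⟨K, hK, h⟩ := h
  have h1 : ∀ i, μ.real {σ | σ x = i} = K * y i ^ (d + 1) := by
    intro i
    have := h fun _ => i
    rw [treeWeight_singleton] at this
    simpa using this
  have h2 := hasSum_measureReal_inter_preimage_singleton μ MeasurableSet.univ
    (measurable_pi_apply x : Measurable fun σ : V → S => σ x)
  simp only [Set.univ_inter, probReal_univ] at h2
  have h3 : HasSum (fun i => K * y i ^ (d + 1)) 1 := h2.congr_fun fun i => (h1 i).symm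
  have h4 := h3.tsum_eq
  rw [tsum_mul_left] at h4
  rw [h1, invariantLaw, eq_div_iff (right_ne_zero_of_mul_eq_one h4)]
  linear_combination y i ^ (d + 1) * h4

/-- The Markov property for a leaf, integrated over all other vertices of T: it holds for each full
configuration τ on T, and the countably many cases are summed. -/
theorem measureReal_markov_step [DecidableEq V] (hG : G.IsAcyclic)
    (hreg : G.IsRegularOfDegree (d + 1)) (hy : IsRootOfBoundaryLaw d Q y C)
    {μ : Measure (V → S)} [IsProbabilityMeasure μ] {T : Finset V}
    (hT : (G.induce (T : Set V)).Connected) {u v z : V} (hu : u ∈ T) (hz : z ∈ T)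
    (huv : G.Adj u v) (hv : v ∉ T) (h : HasTreeMarginal G Q hQ d y μ (insert v T)) (i l j : S) :
    μ.real {σ | (σ v = i ∧ σ z = j) ∧ σ u = l} =
      transitionProb d Q y C l i * μ.real {σ | σ u = l ∧ σ z = j} := by
  have hsite : ∀ (w : V) (a : S), MeasurableSet {σ : V → S | σ w = a} := fun w a =>
    (measurable_pi_apply w : Measurable fun σ : V → S => σ w) (measurableSet_singleton a)
  have hm : Measurable fun (σ : V → S) (t : T) => σ t :=
    measurable_pi_lambda _ fun t => measurable_pi_apply (t : V)
  have h1 := hasSum_measureReal_inter_preimage_singleton μ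
    (((hsite v i).inter (hsite z j)).inter (hsite u l)) hm
  have h2 := (hasSum_measureReal_inter_preimage_singleton μ
    ((hsite u l).inter (hsite z j)) hm).mul_left (transitionProb d Q y C l i)
  refine h1.unique (h2.congr_fun fun τ => ?_)
  -- The default value i off T makes ω equal to i at the new vertex v.
  let ω : V → S := fun w => if hw : w ∈ T then τ ⟨w, hw⟩ else i
  have hω : ∀ w (hw : w ∈ T), ω w = τ ⟨w, hw⟩ := fun w hw => dif_pos hw
  have hωv : ω v = i := dif_neg hv
  have hτ : ∀ σ : V → S, ((fun t : T => σ t) = τ ↔ ∀ w ∈ T, σ w = ω w) := by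
    intro σ
    rw [funext_iff]
    constructor
    · intro h w hw; rw [hω w hw]; exact h ⟨w, hw⟩
    · intro h t; rw [h t t.2, hω t t.2]
  by_cases hc : ω u = l ∧ ω z = j
  · have e1 : ({σ : V → S | σ v = i} ∩ {σ | σ z = j} ∩ {σ | σ u = l}) ∩
        (fun σ (t : T) => σ t) ⁻¹' {τ} = {σ | ∀ x ∈ insert v T, σ x = ω x} := by
      ext σ
      simp only [Set.mem_inter_iff, Set.mem_ofPred_eq, Set.mem_preimage, Set.mem_singleton_iff,
        hτ, Finset.forall_mem_insert, hωv]
      constructor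
      · rintro ⟨⟨⟨h1, -⟩, -⟩, h2⟩; exact ⟨h1, h2⟩
      · rintro ⟨h1, h2⟩
        exact ⟨⟨⟨h1, (h2 z hz).trans hc.2⟩, (h2 u hu).trans hc.1⟩, h2⟩
    have e2 : ({σ : V → S | σ u = l} ∩ {σ | σ z = j}) ∩
        (fun σ (t : T) => σ t) ⁻¹' {τ} = {σ | ∀ x ∈ T, σ x = ω x} := by
      ext σ
      simp only [Set.mem_inter_iff, Set.mem_ofPred_eq, Set.mem_preimage, Set.mem_singleton_iff, hτ]
      constructor
      · rintro ⟨-, h2⟩; exact h2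
      · intro h2
        exact ⟨⟨(h2 u hu).trans hc.1, (h2 z hz).trans hc.2⟩, h2⟩
    rw [e1, e2, h.measureReal_insert hG hreg hy hT hu huv hv, hωv, hc.1, mul_comm]
  · have e1 : ({σ : V → S | σ v = i} ∩ {σ | σ z = j} ∩ {σ | σ u = l}) ∩
        (fun σ (t : T) => σ t) ⁻¹' {τ} = ∅ := by
      ext σ
      simp only [Set.mem_inter_iff, Set.mem_ofPred_eq, Set.mem_preimage, Set.mem_singleton_iff,
        hτ, Set.mem_empty_iff_false, iff_false]
      rintro ⟨⟨⟨-, h2⟩, h3⟩, h4⟩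
      exact hc ⟨(h4 u hu).symm.trans h3, (h4 z hz).symm.trans h2⟩
    have e2 : ({σ : V → S | σ u = l} ∩ {σ | σ z = j}) ∩
        (fun σ (t : T) => σ t) ⁻¹' {τ} = ∅ := by
      ext σ
      simp only [Set.mem_inter_iff, Set.mem_ofPred_eq, Set.mem_preimage, Set.mem_singleton_iff,
        hτ, Set.mem_empty_iff_false, iff_false]
      rintro ⟨⟨h3, h2⟩, h4⟩
      exact hc ⟨(h4 u hu).symm.trans h3, (h4 z hz).symm.trans h2⟩
    rw [e1, e2]
    simp

/-- The joint law of the states at the two ends of a path. -/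
theorem measureReal_two_point [DecidableEq V] (hG : G.IsAcyclic)
    (hreg : G.IsRegularOfDegree (d + 1)) (hy : IsRootOfBoundaryLaw d Q y C)
    {μ : Measure (V → S)} [IsProbabilityMeasure μ]
    (h : ∀ T : Finset V, (G.induce (T : Set V)).Connected → HasTreeMarginal G Q hQ d y μ T)
    (j : S) {x z : V} (p : G.Walk x z) (hp : p.IsPath) (i : S) :
    μ.real {σ | σ x = i ∧ σ z = j} =
      invariantLaw d y i * (markovApply (transitionProb d Q y C))^[p.length]
        (Set.indicator {j} 1) i := by
  induction p generalizing i with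
  | @nil x =>
    have hs := measureReal_site
      (h {x} (by rw [Finset.coe_singleton]; exact connected_induce_singleton x)) i
    by_cases hij : i = j
    · subst hij
      simpa using hs
    · have : {σ : V → S | σ x = i ∧ σ x = j} = ∅ := by
        ext σ
        simp only [Set.mem_ofPred_eq, Set.mem_empty_iff_false, iff_false]
        rintro ⟨h1, h2⟩
        exact hij (h1.symm.trans h2)
      simp [this, hij]
  | @cons x u z hxu q ih =>
    rw [Walk.cons_isPath_iff] at hp
    have hqc := q.connected_induce_support_toFinset
    have hxq : x ∉ q.support.toFinset := by simpa using hp.2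
    have hstep := measureReal_markov_step hG hreg hy hqc (by simp) (z := z) (by simp)
      hxu.symm hxq (h _ (by
        rw [Finset.coe_insert]; exact hqc.induce_insert (by simp) hxu.symm)) i
    have hsite : ∀ (w : V) (a : S), MeasurableSet {σ : V → S | σ w = a} := fun w a =>
      (measurable_pi_apply w : Measurable fun σ : V → S => σ w) (measurableSet_singleton a)
    have h1 := hasSum_measureReal_inter_preimage_singleton μ ((hsite x i).inter (hsite z j))
      (measurable_pi_apply u)
    have h2 : ∀ l, μ.real ({σ : V → S | σ x = i} ∩ {σ | σ z = j} ∩ (fun σ => σ u) ⁻¹' {l}) =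
        invariantLaw d y i * (transitionProb d Q y C i l *
          (markovApply (transitionProb d Q y C))^[q.length] (Set.indicator {j} 1) l) := by
      intro l
      refine (hstep l j).trans ?_
      -- The leaf x hangs on u, so the step produces P(l,i). Reversibility turns α(l) P(l,i) into
      -- α(i) P(i,l), which points along the path.
      rw [ih hp.1, ← mul_assoc, mul_comm (transitionProb d Q y C l i),
        hy.invariantLaw_mul_transitionProb hQ l i, mul_assoc]
    simp only [h2] at h1
    rw [Walk.length_cons, Function.iterate_succ_apply', markovApply, ← tsum_mul_left]
    exact h1.tsum_eq.symm

/-- The increments along longer and longer paths converge in law to the difference of two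
independent variables distributed according to the invariant law. -/
theorem IsBoundaryLawChain.tendsto_measureReal_sub_eq (hG : G.IsAcyclic)
    (hreg : G.IsRegularOfDegree (d + 1)) (hy : IsRootOfBoundaryLaw d Q y C)
    (hsum : Summable fun i => y i ^ (d + 1)) {c : ℝ} (hc : 0 < c) {lam : S → ℝ}
    (hlam : ∀ i, lam i = c * y i ^ d) {μ : Measure (V → S)} (h : IsBoundaryLawChain G Q hQ lam μ)
    (k : S) (x z : ℕ → V) (p : ∀ n, G.Walk (x n) (z n))
    (hp : ∀ n, (p n).IsPath ∧ (p n).length = n) :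
    Tendsto (fun n => μ.real {σ | σ (z n) - σ (x n) = k}) atTop
      (𝓝 (∑' i, invariantLaw d y i * invariantLaw d y (i + k))) := by
  classical
  have := h.prob
  set P := transitionProb d Q y C with hP
  have hind : ∀ j i : S, |Set.indicator {j} (1 : S → ℝ) i| ≤ 1 := by
    intro j i
    by_cases hij : i = j
    · simp [hij]
    · simp [hij]
  have h1 : ∀ n, μ.real {σ | σ (z n) - σ (x n) = k} =
      ∑' i, invariantLaw d y i * (markovApply P)^[n] (Set.indicator {i + k} 1) i := by
    intro n
    have hm : MeasurableSet {σ : V → S | σ (z n) - σ (x n) = k} := by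
      have : Measurable fun σ : V → S => σ (z n) - σ (x n) := by
        have h2 : Measurable fun s : S × S => s.1 - s.2 := measurable_of_countable _
        have h3 : Measurable fun σ : V → S => (σ (z n), σ (x n)) :=
          (measurable_pi_apply (z n)).prodMk (measurable_pi_apply (x n))
        exact h2.comp h3
      exact this (measurableSet_singleton k)
    rw [← (hasSum_measureReal_inter_preimage_singleton μ hm
      (measurable_pi_apply (x n))).tsum_eq]
    refine tsum_congr fun i => ?_
    have h3 := measureReal_two_point hG hreg hy
      (fun T hT => h.hasTreeMarginal hG hreg hy hc hlam hT) (i + k) (p n) (hp n).1 i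
    rw [(hp n).2] at h3
    rw [← h3]
    congr 1
    ext σ
    simp only [Set.mem_inter_iff, Set.mem_ofPred_eq, Set.mem_preimage, Set.mem_singleton_iff]
    constructor
    · rintro ⟨h4, h5⟩
      exact ⟨h5, by rw [← h4, ← h5]; abel⟩
    · rintro ⟨h4, h5⟩
      exact ⟨by rw [h4, h5]; abel, h4⟩
  simp only [h1]
  have hα := hy.hasSum_invariantLaw hsum
  have hα0 := hy.invariantLaw_pos hsum
  have hP0 := hy.transitionProb_pos
  have hit : ∀ (n : ℕ) (f : S → ℝ), (∀ i, |f i| ≤ 1) → ∀ i, |(markovApply P)^[n] f i| ≤ 1 := by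
    intro n
    induction n with
    | zero => exact fun f hf => hf
    | succ n ih =>
      intro f hf i
      rw [Function.iterate_succ_apply']
      exact abs_markovApply_le (fun i j => (hP0 i j).le) hy.hasSum_transitionProb (ih f hf) i
  -- For fixed i, the iterates of the indicator of i + k tend to α(i+k); they stay bounded by 1, so
  -- α dominates the series.
  refine tendsto_tsum_of_dominated_convergence (bound := fun i => invariantLaw d y i)
    hα.summable (fun i => ?_) (Eventually.of_forall fun n i => ?_)
  · refine Tendsto.const_mul _ ?_
    have h2 := tendsto_iterate_markovApply hP0 hy.hasSum_transitionProb hα0 hα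
      (hy.hasSum_invariantLaw_mul_transitionProb hQ) (hind (i + k)) i
    convert h2 using 2
    rw [tsum_eq_single (i + k)]
    · simp
    · intro j hj; simp [hj]
  · rw [Real.norm_eq_abs, abs_mul, abs_of_pos (hα0 i)]
    exact mul_le_of_le_one_right (hα0 i).le (hit n _ (hind _) i)

end TwoPoint

/-! ### Hölder and Young inequalities for power sums -/

section PowerSums

open ENNReal

/-- Hölder's inequality for three sequences with the exponents `d+1, d+1, (d+1)/(d-1)`. -/
theorem ENNReal.tsum_mul_mul_pow_le {ι : Type*} {d : ℕ} (hd : 1 ≤ d) (a b z : ι → ℝ≥0∞) :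
    (∑' i, a i * b i * z i ^ (d - 1)) ^ (d + 1) ≤
      (∑' i, a i ^ (d + 1)) * (∑' i, b i ^ (d + 1)) * (∑' i, z i ^ (d + 1)) ^ (d - 1) := by
  let _ : MeasurableSpace ι := ⊤
  have hp : (0 : ℝ) < ((d + 1 : ℕ) : ℝ) := by positivity
  set p : ℝ := ((d + 1 : ℕ) : ℝ) with hpdef
  have hd1 : ((d - 1 : ℕ) : ℝ) = p - 2 := by
    rw [Nat.cast_sub hd, hpdef]; push_cast; ring
  have h1 := ENNReal.lintegral_prod_norm_pow_le (μ := (Measure.count : Measure ι))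
    (Finset.univ : Finset (Fin 3))
    (f := ![fun i => a i ^ (d + 1), fun i => b i ^ (d + 1), fun i => z i ^ (d + 1)])
    (fun i _ => measurable_from_top.aemeasurable)
    (p := ![1 / p, 1 / p, ((d - 1 : ℕ) : ℝ) / p])
    (by
      simp only [Fin.sum_univ_three, Matrix.cons_val_zero, Matrix.cons_val_one, Matrix.cons_val]
      rw [hd1]; field_simp; ring)
    (by
      intro i _
      fin_cases i <;> simp <;> positivity)
  simp only [Fin.prod_univ_three, Matrix.cons_val_zero, Matrix.cons_val_one, Matrix.cons_val,
    lintegral_count] at h1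
  have hroot : ∀ t : ℝ≥0∞, (t ^ (d + 1)) ^ (1 / p) = t := by
    intro t
    rw [← ENNReal.rpow_natCast, ← ENNReal.rpow_mul, ← hpdef, mul_one_div_cancel hp.ne',
      ENNReal.rpow_one]
  have hroot' : ∀ t : ℝ≥0∞, (t ^ (1 / p)) ^ (d + 1) = t := by
    intro t
    rw [← ENNReal.rpow_natCast, ← ENNReal.rpow_mul, ← hpdef, one_div_mul_cancel hp.ne',
      ENNReal.rpow_one]
  have hsplit : ∀ t : ℝ≥0∞, t ^ (((d - 1 : ℕ) : ℝ) / p) = (t ^ (1 / p)) ^ (d - 1) := by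
    intro t
    rw [← ENNReal.rpow_natCast, ← ENNReal.rpow_mul]
    congr 1; ring
  simp only [hsplit, hroot] at h1
  refine (pow_le_pow_left' h1 (d + 1)).trans (le_of_eq ?_)
  rw [mul_pow, mul_pow, hroot', hroot', ← pow_mul, mul_comm (d - 1), pow_mul, hroot']

/-- Young's inequality for the convolution with `r²`. -/
theorem ENNReal.tsum_conv_pow_le {d : ℕ} (hd : 1 ≤ d) (r : ℤ → ℝ≥0∞) (s : Set ℤ)
    (h z : s → ℝ≥0∞) :
    ∑' i : s, (∑' j : s, r ((i : ℤ) - j) ^ 2 * h j * z j ^ (d - 1)) ^ (d + 1) ≤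
      (∑' i, r i ^ (d + 1)) ^ 2 * (∑' j, h j ^ (d + 1)) * (∑' j, z j ^ (d + 1)) ^ (d - 1) := by
  set A := ∑' i, r i ^ (d + 1) with hA
  set Z := ∑' j, z j ^ (d + 1) with hZ
  have hrow : ∀ i : s, ∑' j : s, r ((i : ℤ) - j) ^ (d + 1) ≤ A := fun i =>
    ENNReal.tsum_comp_le_tsum_of_injective
      (f := fun j : s => (i : ℤ) - j) (fun a b hab => Subtype.ext (sub_right_injective hab))
      fun n => r n ^ (d + 1)
  have hcol : ∀ j : s, ∑' i : s, r ((i : ℤ) - j) ^ (d + 1) ≤ A := fun j =>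
    ENNReal.tsum_comp_le_tsum_of_injective
      (f := fun i : s => (i : ℤ) - j) (fun a b hab => Subtype.ext (sub_left_injective hab))
      fun n => r n ^ (d + 1)
  calc ∑' i : s, (∑' j : s, r ((i : ℤ) - j) ^ 2 * h j * z j ^ (d - 1)) ^ (d + 1)
      ≤ ∑' i : s, (∑' j : s, r ((i : ℤ) - j) ^ (d + 1) * h j ^ (d + 1)) * (A * Z ^ (d - 1)) := by
        refine ENNReal.tsum_le_tsum fun i => ?_
        -- Hölder is applied to the factors r h, r and z^(d-1): one copy of r is paired with h and
        -- survives as a convolution, the other is bounded by the full sum of r^(d+1).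
        have h1 := ENNReal.tsum_mul_mul_pow_le hd (fun j : s => r ((i : ℤ) - j) * h j)
          (fun j : s => r ((i : ℤ) - j)) z
        have h2 : ∀ j : s, r ((i : ℤ) - j) * h j * r ((i : ℤ) - j) * z j ^ (d - 1) =
            r ((i : ℤ) - j) ^ 2 * h j * z j ^ (d - 1) := fun j => by ring
        simp only [h2, mul_pow] at h1
        refine h1.trans ?_
        rw [mul_assoc]
        gcongr
        exact hrow i
    _ = (∑' j : s, (∑' i : s, r ((i : ℤ) - j) ^ (d + 1)) * h j ^ (d + 1)) * (A * Z ^ (d - 1)) := by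
        rw [ENNReal.tsum_mul_right, ENNReal.tsum_comm]
        simp only [ENNReal.tsum_mul_right]
    _ ≤ (∑' j : s, A * h j ^ (d + 1)) * (A * Z ^ (d - 1)) := by
        gcongr with j
        exact hcol j
    _ = A ^ 2 * (∑' j, h j ^ (d + 1)) * Z ^ (d - 1) := by
        rw [ENNReal.tsum_mul_left]; ring

variable {ι : Type*} {d : ℕ}

theorem natCast_succ_toReal (d : ℕ) : ((d + 1 : ℕ) : ℝ≥0∞).toReal = ((d + 1 : ℕ) : ℝ) :=
  ENNReal.toReal_natCast _

instance fact_one_le_natCast_succ (d : ℕ) : Fact (1 ≤ ((d + 1 : ℕ) : ℝ≥0∞)) :=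
  ⟨by exact_mod_cast Nat.le_add_left 1 d⟩

theorem lp.tsum_enorm_pow (f : lp (fun _ : ι => ℝ) ((d + 1 : ℕ) : ℝ≥0∞)) :
    ∑' i, ‖f i‖ₑ ^ (d + 1) = ‖f‖ₑ ^ (d + 1) := by
  have hp : 0 < ((d + 1 : ℕ) : ℝ≥0∞).toReal := by rw [natCast_succ_toReal]; positivity
  have h1 := lp.hasSum_norm hp f
  rw [natCast_succ_toReal] at h1
  simp only [Real.rpow_natCast] at h1
  have h2 := ENNReal.ofReal_tsum_of_nonneg (fun i => pow_nonneg (norm_nonneg (f i)) (d + 1))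
    h1.summable
  rw [h1.tsum_eq] at h2
  simp only [ENNReal.ofReal_pow (norm_nonneg _), ofReal_norm] at h2
  exact h2.symm

/-- Estimates are made for power sums in `ℝ≥0∞`, where summability is not an issue; this converts
them into elements of ℓ_(d+1) with a norm bound. -/
theorem lp.exists_of_tsum_enorm_pow_le {g : ι → ℝ} {c : ℝ} (hc : 0 ≤ c)
    (h : ∑' i, ‖g i‖ₑ ^ (d + 1) ≤ ENNReal.ofReal c ^ (d + 1)) :
    ∃ f : lp (fun _ : ι => ℝ) ((d + 1 : ℕ) : ℝ≥0∞), (∀ i, f i = g i) ∧ ‖f‖ ≤ c := by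
  have hp : 0 < ((d + 1 : ℕ) : ℝ≥0∞).toReal := by rw [natCast_succ_toReal]; positivity
  have h1 : Summable fun i => g i ^ (d + 1) := by
    refine Summable.of_enorm (ne_top_of_le_ne_top ?_ (le_trans (le_of_eq ?_) h))
    · finiteness
    · simp only [enorm_pow]
  have hm : Memℓp g ((d + 1 : ℕ) : ℝ≥0∞) := by
    refine memℓp_gen ?_
    rw [natCast_succ_toReal]
    simpa only [Real.rpow_natCast, norm_pow] using h1.norm
  refine ⟨⟨g, hm⟩, fun _ => rfl, ?_⟩
  have h2 := lp.tsum_enorm_pow (d := d) (⟨g, hm⟩ : lp (fun _ : ι => ℝ) ((d + 1 : ℕ) : ℝ≥0∞))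
  have h3 : ‖(⟨g, hm⟩ : lp (fun _ : ι => ℝ) ((d + 1 : ℕ) : ℝ≥0∞))‖ₑ ^ (d + 1) ≤
      ENNReal.ofReal c ^ (d + 1) := h2 ▸ h
  have h4 := (ENNReal.pow_le_pow_left_iff (Nat.succ_ne_zero d)).1 h3
  rwa [← ofReal_norm, ENNReal.ofReal_le_ofReal_iff hc] at h4

theorem memEll_iff {S : Set ℤ} {x : ℤ → ℝ} :
    MemEll ((d : ℝ) + 1) S x ↔ Summable fun j : S => |x j| ^ (d + 1) := by
  unfold MemEll
  have : ∀ t : ℝ, t ^ ((d : ℝ) + 1) = t ^ (d + 1) := fun t => by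
    rw [← Real.rpow_natCast]; push_cast; rfl
  simp only [this]

theorem ellNorm_nonneg {p : ℝ} {S : Set ℤ} {x : ℤ → ℝ} : 0 ≤ ellNorm p S x :=
  Real.rpow_nonneg (tsum_nonneg fun _ => Real.rpow_nonneg (abs_nonneg _) _) _

theorem ellNorm_pow {S : Set ℤ} {x : ℤ → ℝ} :
    ellNorm ((d : ℝ) + 1) S x ^ (d + 1) = ∑' j : S, |x j| ^ (d + 1) := by
  unfold ellNorm
  have : ∀ t : ℝ, t ^ ((d : ℝ) + 1) = t ^ (d + 1) := fun t => by
    rw [← Real.rpow_natCast]; push_cast; rfl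
  simp only [this]
  rw [← Real.rpow_natCast, ← Real.rpow_mul (tsum_nonneg fun _ => pow_nonneg (abs_nonneg _) _)]
  push_cast
  rw [one_div_mul_cancel (by positivity), Real.rpow_one]

end PowerSums

/-! ### The localized boundary law as a fixed point -/

section LocalizedBoundaryLaw

open ENNReal

variable {d : ℕ} {Q : ℤ → ℝ}

/-- From |a^d - b^d| ≤ d |a-b| max(|a|,|b|)^(d-1), with the maximum bounded by a sum so that each
term on the right is again a three-factor sum controlled by Hölder. -/
theorem abs_tsum_mul_pow_sub_le {ι : Type*} (hd : 1 ≤ d) {w x y : ι → ℝ} (hw : ∀ j, 0 ≤ w j)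
    (hx : Summable fun j => w j * |x j| * |x j| ^ (d - 1))
    (hy : Summable fun j => w j * |y j| * |y j| ^ (d - 1))
    (hxy : Summable fun j => w j * |x j - y j| * |x j| ^ (d - 1))
    (hyx : Summable fun j => w j * |x j - y j| * |y j| ^ (d - 1)) :
    |(∑' j, w j * |x j| * |x j| ^ (d - 1)) - ∑' j, w j * |y j| * |y j| ^ (d - 1)| ≤
      d * ((∑' j, w j * |x j - y j| * |x j| ^ (d - 1)) +
        ∑' j, w j * |x j - y j| * |y j| ^ (d - 1)) := by
  rw [← hx.tsum_sub hy, ← hxy.tsum_add hyx, ← tsum_mul_left]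
  have hs := (hxy.add hyx).mul_left (d : ℝ)
  have hle : ∀ j, ‖w j * |x j| * |x j| ^ (d - 1) - w j * |y j| * |y j| ^ (d - 1)‖ ≤
      d * (w j * |x j - y j| * |x j| ^ (d - 1) + w j * |x j - y j| * |y j| ^ (d - 1)) := by
    intro j
    have h1 : w j * |x j| * |x j| ^ (d - 1) - w j * |y j| * |y j| ^ (d - 1) =
        w j * (|x j| ^ d - |y j| ^ d) := by
      rw [mul_assoc, mul_assoc, mul_pow_sub_one (by omega), mul_pow_sub_one (by omega)]
      ring
    have h2 := abs_pow_sub_pow_le (|x j|) (|y j|) d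
    rw [abs_abs, abs_abs] at h2
    have h3 : max |x j| |y j| ^ (d - 1) ≤ |x j| ^ (d - 1) + |y j| ^ (d - 1) := by
      rcases max_choice |x j| |y j| with h | h <;> rw [h]
      · exact le_add_of_nonneg_right (pow_nonneg (abs_nonneg _) _)
      · exact le_add_of_nonneg_left (pow_nonneg (abs_nonneg _) _)
    rw [h1, Real.norm_eq_abs, abs_mul, abs_of_nonneg (hw j)]
    calc w j * |(|x j| ^ d - |y j| ^ d)|
        ≤ w j * (|x j - y j| * d * (|x j| ^ (d - 1) + |y j| ^ (d - 1))) := by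
          refine mul_le_mul_of_nonneg_left (h2.trans ?_) (hw j)
          refine mul_le_mul (mul_le_mul_of_nonneg_right (abs_abs_sub_abs_le _ _)
            (Nat.cast_nonneg d)) h3 (by positivity) (by positivity)
      _ = _ := by ring
  exact tsum_of_norm_bounded hs.hasSum hle

/-- In terms of r = √Q, the assumption says r ∈ ℓ_(d+1), and γ is the square of its norm; this is
why the exponent (d+1)/2 appears. -/
theorem summable_sqrt_pow (hpos : ∀ j, 0 < Q j) (hQ : MemEll (((d : ℝ) + 1) / 2) Set.univ Q) :
    Summable (fun i => √(Q i) ^ (d + 1)) ∧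
      (∑' i, √(Q i) ^ (d + 1)) ^ 2 = ellNorm (((d : ℝ) + 1) / 2) Set.univ Q ^ (d + 1) := by
  have h1 : ∀ i, |Q i| ^ (((d : ℝ) + 1) / 2) = √(Q i) ^ (d + 1) := by
    intro i
    rw [abs_of_pos (hpos i), Real.sqrt_eq_rpow, ← Real.rpow_natCast, ← Real.rpow_mul (hpos i).le]
    congr 1
    push_cast
    ring
  unfold MemEll at hQ
  simp only [h1] at hQ
  refine ⟨((Equiv.Set.univ ℤ).summable_iff (f := fun i => √(Q i) ^ (d + 1))).1 hQ, ?_⟩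
  unfold ellNorm
  simp only [h1]
  rw [tsum_univ (f := fun i : ℤ => √(Q i) ^ (d + 1)), ← Real.rpow_natCast (n := d + 1),
    ← Real.rpow_mul (tsum_nonneg fun _ => by positivity), ← Real.rpow_natCast]
  congr 1
  push_cast
  field_simp

theorem summable_pow_of_memEll (hpos : ∀ j, 0 < Q j)
    (hQ : MemEll (((d : ℝ) + 1) / 2) Set.univ Q) : Summable fun i => Q i ^ (d + 1) := by
  obtain ⟨h1, -⟩ := summable_sqrt_pow hpos hQ
  have h2 := h1.mul_bounded (f := fun i => √(Q i) ^ (d + 1)) (M := ∑' i, √(Q i) ^ (d + 1))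
    (fun i => by positivity) (fun i => by
      rw [abs_of_nonneg (by positivity)]
      exact h1.le_tsum i fun j _ => by positivity)
  refine h2.congr fun i => ?_
  rw [← mul_pow, Real.mul_self_sqrt (hpos i).le]

/-- The convolution estimate for the numerator of the fixed point operator. -/
theorem exists_conv (hd : 1 ≤ d) (hpos : ∀ j, 0 < Q j)
    (hQ : MemEll (((d : ℝ) + 1) / 2) Set.univ Q)
    (h z : lp (fun _ : ({0}ᶜ : Set ℤ) => ℝ) ((d + 1 : ℕ) : ℝ≥0∞)) :
    (∀ i : ({0}ᶜ : Set ℤ),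
      Summable fun j : ({0}ᶜ : Set ℤ) => Q ((i : ℤ) - j) * |h j| * |z j| ^ (d - 1)) ∧
    ∃ c : lp (fun _ : ({0}ᶜ : Set ℤ) => ℝ) ((d + 1 : ℕ) : ℝ≥0∞),
      (∀ i, c i = ∑' j : ({0}ᶜ : Set ℤ), Q ((i : ℤ) - j) * |h j| * |z j| ^ (d - 1)) ∧
      ‖c‖ ≤ ellNorm (((d : ℝ) + 1) / 2) Set.univ Q * ‖h‖ * ‖z‖ ^ (d - 1) := by
  set γ := ellNorm (((d : ℝ) + 1) / 2) Set.univ Q with hγ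
  have hγ0 : 0 ≤ γ := ellNorm_nonneg
  obtain ⟨hs, hs2⟩ := summable_sqrt_pow hpos hQ
  have h1 := ENNReal.tsum_conv_pow_le hd (fun n => ‖√(Q n)‖ₑ) ({0}ᶜ : Set ℤ)
    (fun j => ‖h j‖ₑ) (fun j => ‖z j‖ₑ)
  have h2 : (∑' i, ‖√(Q i)‖ₑ ^ (d + 1)) ^ 2 = ENNReal.ofReal γ ^ (d + 1) := by
    rw [← ENNReal.ofReal_pow hγ0, ← hs2,
      ENNReal.ofReal_pow (tsum_nonneg fun _ => by positivity),
      ENNReal.ofReal_tsum_of_nonneg (fun _ => by positivity) hs]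
    congr 2
    ext i
    rw [← ofReal_norm, Real.norm_of_nonneg (Real.sqrt_nonneg _),
      ENNReal.ofReal_pow (Real.sqrt_nonneg _)]
  have h3 : ∀ i j : ({0}ᶜ : Set ℤ), ‖√(Q ((i : ℤ) - j))‖ₑ ^ 2 * ‖h j‖ₑ * ‖z j‖ₑ ^ (d - 1) =
      ‖Q ((i : ℤ) - j) * |h j| * |z j| ^ (d - 1)‖ₑ := by
    intro i j
    rw [enorm_mul, enorm_mul, enorm_pow, Real.enorm_abs, Real.enorm_abs, ← enorm_pow,
      Real.sq_sqrt (hpos _).le]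
  simp only [h3] at h1
  rw [h2, lp.tsum_enorm_pow, lp.tsum_enorm_pow] at h1
  have h4 : ENNReal.ofReal γ ^ (d + 1) * ‖h‖ₑ ^ (d + 1) * (‖z‖ₑ ^ (d + 1)) ^ (d - 1) =
      ENNReal.ofReal (γ * ‖h‖ * ‖z‖ ^ (d - 1)) ^ (d + 1) := by
    rw [ENNReal.ofReal_mul (by positivity), ENNReal.ofReal_mul hγ0,
      ENNReal.ofReal_pow (norm_nonneg _), ofReal_norm, ofReal_norm, mul_pow, mul_pow,
      ← pow_mul, ← pow_mul, mul_comm (d + 1)]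
  rw [h4] at h1
  have hfin : ENNReal.ofReal (γ * ‖h‖ * ‖z‖ ^ (d - 1)) ^ (d + 1) ≠ ⊤ := by finiteness
  constructor
  · intro i
    refine Summable.of_enorm fun htop => ?_
    have h5 := (ENNReal.le_tsum i).trans h1
    rw [htop, ENNReal.top_pow (Nat.succ_ne_zero d)] at h5
    exact hfin (top_le_iff.1 h5)
  · refine lp.exists_of_tsum_enorm_pow_le (by positivity) (le_trans ?_ h1)
    gcongr with i
    exact enorm_tsum_le_tsum_enorm

/-- The estimate for the denominator of the fixed point operator. -/
theorem summable_pairing (hd : 1 ≤ d) (hpos : ∀ j, 0 < Q j)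
    (hQ : MemEll (((d : ℝ) + 1) / 2) Set.univ Q)
    (h z : lp (fun _ : ({0}ᶜ : Set ℤ) => ℝ) ((d + 1 : ℕ) : ℝ≥0∞)) :
    (Summable fun j : ({0}ᶜ : Set ℤ) => Q j * |h j| * |z j| ^ (d - 1)) ∧
      ∑' j : ({0}ᶜ : Set ℤ), Q j * |h j| * |z j| ^ (d - 1) ≤
        ellNorm ((d : ℝ) + 1) {0}ᶜ Q * ‖h‖ * ‖z‖ ^ (d - 1) := by
  set δ := ellNorm ((d : ℝ) + 1) {0}ᶜ Q with hδ
  have hδ0 : 0 ≤ δ := ellNorm_nonneg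
  have h1 := ENNReal.tsum_mul_mul_pow_le hd (fun j : ({0}ᶜ : Set ℤ) => ‖Q j‖ₑ)
    (fun j => ‖h j‖ₑ) (fun j => ‖z j‖ₑ)
  have h2 : ∑' j : ({0}ᶜ : Set ℤ), ‖Q j‖ₑ ^ (d + 1) = ENNReal.ofReal δ ^ (d + 1) := by
    rw [← ENNReal.ofReal_pow hδ0, hδ, ellNorm_pow, ENNReal.ofReal_tsum_of_nonneg
      (fun _ => by positivity)]
    · refine tsum_congr fun j => ?_
      rw [← ofReal_norm, Real.norm_eq_abs, ENNReal.ofReal_pow (abs_nonneg _)]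
    · refine ((summable_pow_of_memEll hpos hQ).subtype ({0}ᶜ : Set ℤ)).congr fun j => ?_
      rw [abs_of_pos (hpos _)]; rfl
  have h3 : ∀ j : ({0}ᶜ : Set ℤ), ‖Q j‖ₑ * ‖h j‖ₑ * ‖z j‖ₑ ^ (d - 1) =
      ‖Q j * |h j| * |z j| ^ (d - 1)‖ₑ := by
    intro j
    rw [enorm_mul, enorm_mul, enorm_pow, Real.enorm_abs, Real.enorm_abs]
  simp only [h3] at h1
  have h4 : ENNReal.ofReal δ ^ (d + 1) * ‖h‖ₑ ^ (d + 1) * (‖z‖ₑ ^ (d + 1)) ^ (d - 1) =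
      ENNReal.ofReal (δ * ‖h‖ * ‖z‖ ^ (d - 1)) ^ (d + 1) := by
    rw [ENNReal.ofReal_mul (by positivity), ENNReal.ofReal_mul hδ0,
      ENNReal.ofReal_pow (norm_nonneg _), ofReal_norm, ofReal_norm, mul_pow, mul_pow,
      ← pow_mul, ← pow_mul, mul_comm (d + 1)]
  rw [h2, lp.tsum_enorm_pow, lp.tsum_enorm_pow, h4,
    ENNReal.pow_le_pow_left_iff (Nat.succ_ne_zero d)] at h1
  have hs : Summable fun j : ({0}ᶜ : Set ℤ) => Q j * |h j| * |z j| ^ (d - 1) :=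
    Summable.of_enorm (ne_top_of_le_ne_top ENNReal.ofReal_ne_top h1)
  refine ⟨hs, ?_⟩
  have hnn : ∀ j : ({0}ᶜ : Set ℤ), 0 ≤ Q j * |h j| * |z j| ^ (d - 1) := fun j =>
    mul_nonneg (mul_nonneg (hpos _).le (abs_nonneg _)) (pow_nonneg (abs_nonneg _) _)
  rw [← ENNReal.ofReal_le_ofReal_iff (by positivity), ENNReal.ofReal_tsum_of_nonneg hnn hs]
  refine le_trans (le_of_eq (tsum_congr fun j => ?_)) h1
  rw [← ofReal_norm, Real.norm_of_nonneg (hnn j)]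

/-- Banach's fixed point theorem on the closed ball of radius ε in ℓ_(d+1)(ℤ ∖ {0}). -/
theorem exists_isLocalizedBoundaryLaw (hd : 1 ≤ d) (hpos : ∀ j, 0 < Q j)
    (hQ : MemEll (((d : ℝ) + 1) / 2) Set.univ Q) {ε : ℝ}
    (hε : IsGoodRadius d (ellNorm (((d : ℝ) + 1) / 2) Set.univ Q)
      (ellNorm ((d : ℝ) + 1) {0}ᶜ Q) ε) :
    ∃ lam : ℤ → ℝ, IsLocalizedBoundaryLaw d Q lam := by
  set γ := ellNorm (((d : ℝ) + 1) / 2) Set.univ Q with hγ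
  set δ := ellNorm ((d : ℝ) + 1) {0}ᶜ Q with hδ
  have hγ0 : 0 ≤ γ := ellNorm_nonneg
  have hδ0 : 0 ≤ δ := ellNorm_nonneg
  obtain ⟨hε0, hε1, hε2⟩ := id hε
  let E := lp (fun _ : ({0}ᶜ : Set ℤ) => ℝ) ((d + 1 : ℕ) : ℝ≥0∞)
  have hp0 : ((d + 1 : ℕ) : ℝ≥0∞) ≠ 0 := by simp
  have hqp : ∑' j : ({0}ᶜ : Set ℤ), ‖Q j‖ₑ ^ (d + 1) ≤ ENNReal.ofReal δ ^ (d + 1) := by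
    rw [← ENNReal.ofReal_pow hδ0, hδ, ellNorm_pow, ENNReal.ofReal_tsum_of_nonneg
      (fun _ => by positivity)]
    · refine le_of_eq (tsum_congr fun j => ?_)
      rw [← ofReal_norm, Real.norm_eq_abs, ENNReal.ofReal_pow (abs_nonneg _)]
    · refine ((summable_pow_of_memEll hpos hQ).subtype ({0}ᶜ : Set ℤ)).congr fun j => ?_
      rw [abs_of_pos (hpos _)]; rfl
  obtain ⟨q, hq, hqn⟩ := lp.exists_of_tsum_enorm_pow_le hδ0 hqp
  choose hNs N hN hNn using exists_conv hd hpos hQ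
  have hDs := fun h z => (summable_pairing hd hpos hQ h z).1
  have hDn := fun h z => (summable_pairing hd hpos hQ h z).2
  let D : E → ℝ := fun x => 1 + ∑' j : ({0}ᶜ : Set ℤ), Q j * |x j| * |x j| ^ (d - 1)
  have hD1 : ∀ x, 1 ≤ D x := fun x => le_add_of_nonneg_right (tsum_nonneg fun j =>
    mul_nonneg (mul_nonneg (hpos _).le (abs_nonneg _)) (pow_nonneg (abs_nonneg _) _))
  have hDinv : ∀ x, ‖(D x)⁻¹‖ ≤ 1 := fun x => by
    rw [Real.norm_of_nonneg (inv_nonneg.2 (zero_le_one.trans (hD1 x)))]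
    exact inv_le_one_of_one_le₀ (hD1 x)
  let T : E → E := fun x => (D x)⁻¹ • (q + N x x)
  have hpow : ∀ t : ℝ, t * t ^ (d - 1) = t ^ d := fun t => mul_pow_sub_one (by omega) t
  have hTball : ∀ x : E, ‖x‖ ≤ ε → ‖T x‖ ≤ ε := by
    intro x hx
    calc ‖T x‖ ≤ ‖(D x)⁻¹‖ * ‖q + N x x‖ := (lp.norm_const_smul hp0 _).le
      _ ≤ 1 * (δ + γ * ε ^ d) := by
        refine mul_le_mul (hDinv x) ((norm_add_le _ _).trans (add_le_add hqn ?_))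
          (norm_nonneg _) zero_le_one
        refine (hNn x x).trans ?_
        rw [mul_assoc, hpow]
        gcongr
      _ ≤ ε := by rw [one_mul]; exact hε1
  set κ := 2 * d * γ * ε ^ (d - 1) + 2 * d * δ * ε ^ d with hκ
  have hκ0 : 0 ≤ κ := by positivity
  have hTlip : ∀ x y : E, ‖x‖ ≤ ε → ‖y‖ ≤ ε → ‖T x - T y‖ ≤ κ * ‖x - y‖ := by
    intro x y hx hy
    -- Writing the difference of quotients this way uses only D ≥ 1 and ‖T y‖ ≤ ε. The last bound
    -- supplies the extra ε that makes the second term of κ carry ε^d instead of ε^(d-1).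
    have e1 : T x - T y = (D x)⁻¹ • ((N x x - N y y) + (D y - D x) • T y) := by
      have hDx : D x ≠ 0 := (zero_lt_one.trans_le (hD1 x)).ne'
      have hDy : D y ≠ 0 := (zero_lt_one.trans_le (hD1 y)).ne'
      have e2 : D y • T y = q + N y y := smul_inv_smul₀ hDy _
      have e3 : D x • T x = q + N x x := smul_inv_smul₀ hDx _
      rw [eq_inv_smul_iff₀ hDx, smul_sub, sub_smul, e2, e3]
      abel
    have hsub : ∀ j, (x - y) j = x j - y j := fun j => rfl
    have hb1 : ‖N x x - N y y‖ ≤ 2 * d * γ * ε ^ (d - 1) * ‖x - y‖ := by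
      have h1 : ‖N x x - N y y‖ ≤ ‖(d : ℝ) • (N (x - y) x + N (x - y) y)‖ := by
        refine lp.norm_mono hp0 fun i => ?_
        have h2 := abs_tsum_mul_pow_sub_le hd (fun j : ({0}ᶜ : Set ℤ) => (hpos ((i : ℤ) - j)).le)
          (hNs x x i) (hNs y y i) (hNs (x - y) x i) (hNs (x - y) y i)
        have e4 : (N x x - N y y) i = N x x i - N y y i := rfl
        have e5 : ((d : ℝ) • (N (x - y) x + N (x - y) y)) i =
          d * (N (x - y) x i + N (x - y) y i) := rfl
        rw [e4, e5, hN, hN, hN, hN, Real.norm_eq_abs]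
        exact h2.trans (le_abs_self _)
      refine h1.trans ?_
      calc ‖(d : ℝ) • (N (x - y) x + N (x - y) y)‖
          ≤ d * (γ * ‖x - y‖ * ε ^ (d - 1) + γ * ‖x - y‖ * ε ^ (d - 1)) := by
            rw [lp.norm_const_smul hp0, Real.norm_natCast]
            refine mul_le_mul_of_nonneg_left ((norm_add_le _ _).trans (add_le_add
              ((hNn _ _).trans ?_) ((hNn _ _).trans ?_))) (Nat.cast_nonneg d)
            · gcongr
            · gcongr
        _ = _ := by ring
    have hb2 : ‖D y - D x‖ ≤ 2 * d * δ * ε ^ (d - 1) * ‖x - y‖ := by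
      have h2 := abs_tsum_mul_pow_sub_le hd (fun j : ({0}ᶜ : Set ℤ) => (hpos j).le)
        (hDs x x) (hDs y y) (hDs (x - y) x) (hDs (x - y) y)
      have e4 : D y - D x = -((∑' j : ({0}ᶜ : Set ℤ), Q j * |x j| * |x j| ^ (d - 1)) -
        ∑' j : ({0}ᶜ : Set ℤ), Q j * |y j| * |y j| ^ (d - 1)) := by simp only [D]; ring
      rw [e4, norm_neg, Real.norm_eq_abs]
      refine h2.trans ?_
      calc _ ≤ d * (δ * ‖x - y‖ * ε ^ (d - 1) + δ * ‖x - y‖ * ε ^ (d - 1)) := by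
            refine mul_le_mul_of_nonneg_left (add_le_add
              ((hDn (x - y) x).trans ?_) ((hDn (x - y) y).trans ?_)) (Nat.cast_nonneg d)
            · gcongr
            · gcongr
        _ = _ := by ring
    calc ‖T x - T y‖ ≤ ‖(D x)⁻¹‖ * ‖(N x x - N y y) + (D y - D x) • T y‖ := by
          rw [e1]; exact (lp.norm_const_smul hp0 _).le
      _ ≤ 1 * (2 * d * γ * ε ^ (d - 1) * ‖x - y‖ +
          2 * d * δ * ε ^ (d - 1) * ‖x - y‖ * ε) := by
        refine mul_le_mul (hDinv x) ((norm_add_le _ _).trans (add_le_add hb1 ?_))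
          (norm_nonneg _) zero_le_one
        rw [lp.norm_const_smul hp0]
        exact mul_le_mul hb2 (hTball y hy) (norm_nonneg _) (by positivity)
      _ = κ * ‖x - y‖ := by
        rw [hκ, ← hpow ε]; ring
  have hmaps : Set.MapsTo T (Metric.closedBall 0 ε) (Metric.closedBall 0 ε) := by
    intro x hx
    rw [mem_closedBall_zero_iff] at hx ⊢
    exact hTball x hx
  have hcontr : ContractingWith ⟨κ, hκ0⟩ (hmaps.restrict T _ _) := by
    refine ⟨by exact_mod_cast hε2, LipschitzWith.of_dist_le_mul fun x y => ?_⟩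
    have hx := mem_closedBall_zero_iff.1 x.2
    have hy := mem_closedBall_zero_iff.1 y.2
    rw [Subtype.dist_eq, Subtype.dist_eq, dist_eq_norm, dist_eq_norm]
    exact hTlip x y hx hy
  obtain ⟨x, hx, hfix, -⟩ := hcontr.exists_fixedPoint' Metric.isClosed_closedBall.isComplete hmaps
    (x := 0) (by simp [hε0.le]) (edist_ne_top _ _)
  rw [mem_closedBall_zero_iff] at hx
  let X : ℤ → ℝ := fun i => if hi : i = 0 then 1 else x ⟨i, hi⟩
  have hX : ∀ j : ({0}ᶜ : Set ℤ), X j = x j := fun j => dif_neg j.2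
  refine ⟨fun i => X i ^ d, ε, X, hε, ?_, ?_, dif_pos rfl, fun i hi => ?_, fun _ => rfl⟩
  · rw [memEll_iff]
    simp only [hX]
    have h1 := (lp.memℓp x).summable (by rw [natCast_succ_toReal]; positivity)
    rw [natCast_succ_toReal] at h1
    simpa only [Real.rpow_natCast, Real.norm_eq_abs] using h1
  · rw [← pow_le_pow_iff_left₀ ellNorm_nonneg hε0.le (Nat.succ_ne_zero d), ellNorm_pow]
    simp only [hX]
    have h1 := lp.norm_rpow_eq_tsum (by rw [natCast_succ_toReal]; positivity) x
    rw [natCast_succ_toReal] at h1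
    simp only [Real.rpow_natCast, Real.norm_eq_abs] at h1
    rw [← h1]
    exact pow_le_pow_left₀ (norm_nonneg _) hx _
  · have h1 : x ⟨i, hi⟩ = (D x)⁻¹ * (q ⟨i, hi⟩ + N x x ⟨i, hi⟩) := by
      conv_lhs => rw [← hfix.eq]
      rfl
    have h2 : X i = x ⟨i, hi⟩ := dif_neg hi
    rw [h2, h1, hq, hN, rootOperator]
    simp only [hX, D, mul_assoc, hpow]
    rw [inv_mul_eq_div]

end LocalizedBoundaryLaw

/-! ### The localized boundary law as an eigenfunction -/

section LocalizedChain

open ENNReal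

theorem IsRootOfBoundaryLaw.translate {S : Type*} [AddCommGroup S] {d : ℕ} {Q y : S → ℝ} {C : ℝ}
    (h : IsRootOfBoundaryLaw d Q y C) (i : S) :
    IsRootOfBoundaryLaw d Q (fun j => y (j - i)) C := by
  refine ⟨h.pos_transfer, fun j => h.pos _, h.const_pos, fun j => ?_⟩
  have h1 := (Equiv.subRight i).hasSum_iff.2 (h.hasSum (j - i))
  refine h1.congr_fun fun l => ?_
  simp only [Function.comp_apply, Equiv.subRight_apply, sub_sub_sub_cancel_right]

theorem invariantLaw_translate {S : Type*} [AddCommGroup S] (d : ℕ) (y : S → ℝ) (i j : S) :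
    invariantLaw d (fun j => y (j - i)) j = invariantLaw d y (j - i) := by
  unfold invariantLaw
  congr 1
  exact (Equiv.subRight i).tsum_eq fun l => y l ^ (d + 1)

theorem stationaryLaw_eq_invariantLaw {d : ℕ} (hd : d ≠ 0) {x lam : ℤ → ℝ} (hx : ∀ i, 0 < x i)
    (hlam : ∀ i, lam i = x i ^ d) : stationaryLaw d lam = invariantLaw d x := by
  have h1 : ∀ i, lam i ^ (((d : ℝ) + 1) / d) = x i ^ (d + 1) := by
    intro i
    rw [hlam, ← Real.rpow_natCast, ← Real.rpow_mul (hx i).le, ← Real.rpow_natCast]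
    congr 1
    push_cast
    field_simp
  funext i
  unfold stationaryLaw invariantLaw
  simp only [h1]

/-- The denominator D of the fixed point operator is the eigenvalue. Off 0 this is the fixed point
equation with D cleared, the Q(i) in the numerator being the term j = 0. At 0 it is the definition
of D, since Q is even and Q(0) = x(0) = 1. Positivity of x, read off from the operator, removes the
absolute values. -/
theorem IsLocalizedBoundaryLaw.exists_root {d : ℕ} (hd : 1 ≤ d) {Q lam : ℤ → ℝ}
    (hpos : ∀ j, 0 < Q j) (heven : Function.Even Q) (hzero : Q 0 = 1)
    (hQ : MemEll (((d : ℝ) + 1) / 2) Set.univ Q) (h : IsLocalizedBoundaryLaw d Q lam) :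
    ∃ (x : ℤ → ℝ) (C : ℝ), IsRootOfBoundaryLaw d Q x C ∧ (Summable fun i => x i ^ (d + 1)) ∧
      ∀ i, lam i = x i ^ d := by
  obtain ⟨ε, x, -, hmem, -, hx0, hfix, hlam⟩ := h
  set D := 1 + ∑' j : ({0}ᶜ : Set ℤ), Q j * |x j| ^ d with hD
  have hDpos : 0 < D := add_pos_of_pos_of_nonneg one_pos
    (tsum_nonneg fun j => mul_nonneg (hpos _).le (pow_nonneg (abs_nonneg _) _))
  have hx : ∀ i, 0 < x i := by
    intro i
    by_cases hi : i = 0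
    · rw [hi, hx0]; exact one_pos
    · rw [hfix i hi, rootOperator]
      exact div_pos (add_pos_of_pos_of_nonneg (hpos i)
        (tsum_nonneg fun j => mul_nonneg (hpos _).le (pow_nonneg (abs_nonneg _) _))) hDpos
  have hxs : Summable fun i => x i ^ (d + 1) := by
    rw [memEll_iff] at hmem
    simp only [abs_of_pos (hx _)] at hmem
    exact (Set.finite_singleton (0 : ℤ)).summable_compl_iff.1 hmem
  have hQs := summable_pow_of_memEll hpos hQ
  have hfinite : ∀ f : ℤ → ℝ, (Summable fun i => f i ^ (d + 1)) → (∀ i, 0 < f i) →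
      ∑' i, ‖f i‖ₑ ^ (d + 1) ≠ ⊤ := by
    intro f hf hf0
    simpa only [enorm_norm, enorm_pow] using (tsum_enorm_ne_top_iff_summable_norm.2 hf.norm)
  have hsum : ∀ i, Summable fun j => Q (i - j) * x j ^ d := by
    intro i
    have h1 := ENNReal.tsum_mul_mul_pow_le hd (fun j => ‖Q (i - j)‖ₑ) (fun j => ‖x j‖ₑ)
      (fun j => ‖x j‖ₑ)
    have h2 := hfinite (fun j => Q (i - j))
      ((Equiv.subLeft i).summable_iff (f := fun j => Q j ^ (d + 1)) |>.2 hQs) fun j => hpos _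
    have h3 := hfinite x hxs hx
    refine Summable.of_enorm fun htop => ?_
    have h4 : ∀ j, ‖Q (i - j)‖ₑ * ‖x j‖ₑ * ‖x j‖ₑ ^ (d - 1) = ‖Q (i - j) * x j ^ d‖ₑ := by
      intro j
      rw [enorm_mul, enorm_pow, mul_assoc, mul_pow_sub_one (by omega)]
    simp only [h4] at h1
    rw [htop, ENNReal.top_pow (Nat.succ_ne_zero d)] at h1
    refine absurd (top_le_iff.1 h1) ?_
    exact ENNReal.mul_ne_top (ENNReal.mul_ne_top h2 h3) (ENNReal.pow_ne_top h3)
  refine ⟨x, D, ⟨hpos, hx, hDpos, fun i => ?_⟩, hxs, hlam⟩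
  have h1 := (hsum i).tsum_subtype_add_tsum_subtype_compl {0}
  rw [tsum_singleton 0 fun j => Q (i - j) * x j ^ d, sub_zero, hx0, one_pow, mul_one] at h1
  have h2 : D * x i = ∑' j, Q (i - j) * x j ^ d := by
    rw [← h1]
    by_cases hi : i = 0
    · rw [hi, hx0, mul_one, hD, hzero]
      congr 1
      exact tsum_congr fun j => by rw [zero_sub, heven, abs_of_pos (hx j)]
    · rw [hfix i hi, rootOperator, ← hD, mul_div_cancel₀ _ hDpos.ne']
      congr 1
      exact tsum_congr fun j => by rw [abs_of_pos (hx j)]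
  rw [h2]
  exact (hsum i).hasSum

end LocalizedChain

/-! ### The fuzzy chain and its gradient measure -/

section FuzzyChain

variable {q d : ℕ} {Q lam : ℤ → ℝ}

theorem incrementLaw_nonneg (hpos : ∀ j, 0 < Q j) (j : ℤ) (s : ZMod q) :
    0 ≤ incrementLaw Q q j s := by
  classical
  unfold incrementLaw
  split_ifs
  · exact div_nonneg (hpos j).le (tsum_nonneg fun l => (hpos l).le)
  · exact le_rfl

theorem incrementLaw_neg (heven : Function.Even Q) (j : ℤ) (s : ZMod q) :
    incrementLaw Q q (-j) (-s) = incrementLaw Q q j s := by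
  unfold incrementLaw
  rw [heven, fuzzyQ_even heven, Int.cast_neg]
  simp only [neg_inj]

variable [NeZero q]

theorem onResidues_intCast (hper : Function.Periodic lam (q : ℤ)) (j : ℤ) :
    onResidues q lam (j : ZMod q) = lam j := by
  rw [onResidues, ZMod.val_intCast, Int.emod_def, mul_comm]
  exact hper.sub_int_mul_eq _

theorem intCast_val (s : ZMod q) : (((s.val : ℕ) : ℤ) : ZMod q) = s := by
  rw [Int.cast_natCast, ZMod.natCast_zmod_val]

/-- A positive periodic λ is bounded below by its smallest value, so convergence of ∑ Q(-j) λ(j)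
forces that of ∑ Q. -/
theorem summable_of_isHomBoundaryLaw (hpos : ∀ j, 0 < Q j)
    (hper : Function.Periodic lam (q : ℤ)) (h : IsHomBoundaryLaw d Q lam) : Summable Q := by
  obtain ⟨s, hs⟩ := Finite.exists_min (onResidues q lam)
  have hm : ∀ j, onResidues q lam s ≤ lam j := fun j => by
    rw [← onResidues_intCast hper j]; exact hs _
  have hm0 : 0 < onResidues q lam s := h.pos _
  have h1 : Summable fun j => Q (0 - j) := by
    refine Summable.of_nonneg_of_le (fun j => (hpos _).le) (fun j => ?_)
      ((h.summable 0).mul_left (onResidues q lam s)⁻¹)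
    rw [inv_mul_eq_div, le_div_iff₀ hm0]
    exact mul_le_mul_of_nonneg_left (hm j) (hpos _).le
  exact ((Equiv.subLeft (0 : ℤ)).summable_iff (f := Q)).1 h1

theorem fuzzyQ_pos (hpos : ∀ j, 0 < Q j) (hs : Summable Q) (s : ZMod q) : 0 < fuzzyQ Q q s :=
  (hs.subtype _).tsum_pos (fun l => (hpos l).le) ⟨(s.val : ℤ), intCast_val s⟩ (hpos _)

/-- The sum is grouped by the residue class of j, on which λ is constant. -/
theorem tsum_eq_sum_fuzzyQ_mul (hper : Function.Periodic lam (q : ℤ)) {i : ℤ}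
    (hs : Summable fun j => Q (i - j) * lam j) :
    ∑' j, Q (i - j) * lam j = ∑ s : ZMod q, fuzzyQ Q q ((i : ZMod q) - s) * onResidues q lam s := by
  rw [← (Equiv.sigmaFiberEquiv fun j : ℤ => (j : ZMod q)).tsum_eq]
  refine (((Equiv.sigmaFiberEquiv fun j : ℤ => (j : ZMod q)).summable_iff.2 hs).tsum_sigma).trans ?_
  rw [tsum_fintype]
  refine Finset.sum_congr rfl fun s _ => ?_
  let e : {l : ℤ // (l : ZMod q) = s} ≃ {l : ℤ // (l : ZMod q) = (i : ZMod q) - s} :=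
    (Equiv.subLeft i).subtypeEquiv fun a => by simp
  rw [fuzzyQ, ← e.tsum_eq, ← tsum_mul_right]
  refine tsum_congr fun l => ?_
  have h1 : onResidues q lam s = lam l :=
    (congrArg (onResidues q lam) l.2).symm.trans (onResidues_intCast hper l)
  rw [h1]
  rfl

theorem IsHomBoundaryLaw.onResidues (hper : Function.Periodic lam (q : ℤ))
    (h : IsHomBoundaryLaw d Q lam) : IsHomBoundaryLaw d (fuzzyQ Q q) (onResidues q lam) := by
  obtain ⟨c, hc, heq⟩ := h.eqn
  refine ⟨fun i => h.pos _, fun i => Summable.of_finite, c, hc, fun s => ?_⟩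
  have h1 := tsum_eq_sum_fuzzyQ_mul hper (h.summable (s.val : ℤ))
  rw [intCast_val] at h1
  rw [tsum_fintype, ← h1]
  exact heq _

theorem incrementLaw_pos (hpos : ∀ j, 0 < Q j) (hs : Summable Q) {j : ℤ} {s : ZMod q}
    (hj : (j : ZMod q) = s) : 0 < incrementLaw Q q j s := by
  rw [incrementLaw, if_pos hj]
  exact div_pos (hpos j) (fuzzyQ_pos hpos hs s)

theorem hasSum_incrementLaw (hpos : ∀ j, 0 < Q j) (hs : Summable Q) (s : ZMod q) :
    HasSum (fun j => incrementLaw Q q j s) 1 := by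
  have h1 : HasSum (fun l : {l : ℤ // (l : ZMod q) = s} => Q l) (fuzzyQ Q q s) :=
    (hs.subtype _).hasSum
  have h2 := (hasSum_subtype_iff_indicator (f := Q) (s := {l : ℤ | (l : ZMod q) = s})).1 h1
  have h3 := h2.div_const (fuzzyQ Q q s)
  rw [div_self (fuzzyQ_pos hpos hs s).ne'] at h3
  refine h3.congr_fun fun j => ?_
  by_cases hj : (j : ZMod q) = s
  · rw [incrementLaw, if_pos hj, Set.indicator_of_mem (by exact hj)]
  · rw [incrementLaw, if_neg hj, Set.indicator_of_notMem (by exact hj), zero_div]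

/-- The law of an increment given its residue class, as a measure. -/
theorem exists_incrementMeasure (hpos : ∀ j, 0 < Q j) (hs : Summable Q) :
    ∃ m : ZMod q → Measure ℤ, (∀ s, IsProbabilityMeasure (m s)) ∧
      ∀ s j, m s {j} = ENNReal.ofReal (incrementLaw Q q j s) := by
  choose m hm hm' using fun s : ZMod q => exists_isProbabilityMeasure_of_hasSum
    (fun j => incrementLaw_nonneg hpos j s) (hasSum_incrementLaw hpos hs s)
  exact ⟨m, hm, hm'⟩

open SimpleGraph

variable {V : Type*} {G : SimpleGraph V}

theorem ofReal_integral_prod_incrementLaw (hpos : ∀ j, 0 < Q j) (hs : Summable Q)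
    (P : Measure (V → ZMod q)) [IsProbabilityMeasure P] (A : Finset G.Dart) (ζ : G.Dart → ℤ) :
    ENNReal.ofReal (∫ σ, ∏ e ∈ A, incrementLaw Q q (ζ e) (σ e.snd - σ e.fst) ∂P) =
      ∫⁻ σ, ∏ e ∈ A, ENNReal.ofReal (incrementLaw Q q (ζ e) (σ e.snd - σ e.fst)) ∂P := by
  have hm : ∀ e : G.Dart, Measurable fun σ : V → ZMod q =>
      incrementLaw Q q (ζ e) (σ e.snd - σ e.fst) := by
    intro e
    have h1 : Measurable fun s : ZMod q × ZMod q => incrementLaw Q q (ζ e) (s.1 - s.2) :=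
      measurable_of_countable _
    have h2 : Measurable fun σ : V → ZMod q => (σ e.snd, σ e.fst) :=
      (measurable_pi_apply e.snd).prodMk (measurable_pi_apply e.fst)
    exact h1.comp h2
  have hle : ∀ (j : ℤ) (s : ZMod q), incrementLaw Q q j s ≤ 1 := fun j s =>
    le_hasSum (hasSum_incrementLaw hpos hs s) j fun i _ => incrementLaw_nonneg hpos i s
  have hnn : ∀ σ : V → ZMod q, 0 ≤ ∏ e ∈ A, incrementLaw Q q (ζ e) (σ e.snd - σ e.fst) :=
    fun σ => Finset.prod_nonneg fun e _ => incrementLaw_nonneg hpos _ _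
  have hint : Integrable (fun σ : V → ZMod q =>
      ∏ e ∈ A, incrementLaw Q q (ζ e) (σ e.snd - σ e.fst)) P := by
    refine Integrable.of_bound (Finset.measurable_fun_prod A fun e _ => hm e).aestronglyMeasurable 1
      (Eventually.of_forall fun σ => ?_)
    rw [Real.norm_of_nonneg (hnn σ)]
    exact Finset.prod_le_one (fun e _ => incrementLaw_nonneg hpos _ _) fun e _ => hle _ _
  rw [ofReal_integral_eq_lintegral_ofReal hint (Eventually.of_forall hnn)]
  refine lintegral_congr fun σ => ?_
  exact ENNReal.ofReal_prod_of_nonneg fun e _ => incrementLaw_nonneg hpos _ _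

/-- Existence of the gradient measure obtained from a Markov chain of residues by sampling
independent increments given their residue classes. -/
theorem exists_gradient_measure_of_residues (hpos : ∀ j, 0 < Q j) (heven : Function.Even Q)
    (hs : Summable Q) (P : Measure (V → ZMod q)) [IsProbabilityMeasure P] :
    ∃ ν : Measure (GradConfig G), IsProbabilityMeasure ν ∧
      ∀ A : Finset G.Dart, (∀ e ∈ A, e.symm ∉ A) → ∀ ζ : G.Dart → ℤ,
        ν.real {η | ∀ e ∈ A, η.1 e = ζ e} =
          ∫ σ', ∏ e ∈ A, incrementLaw Q q (ζ e) (σ' e.snd - σ' e.fst) ∂P := by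
  classical
  -- An arbitrary order on the vertices selects one orientation of each edge. Only those increments
  -- are sampled, and the opposite ones are their negatives.
  let _ : LinearOrder V := linearOrderOfSTO (WellOrderingRel (α := V))
  obtain ⟨m, hm, hm'⟩ := exists_incrementMeasure (q := q) hpos hs
  let M : Measure (G.Dart × ZMod q → ℤ) := Measure.infinitePi fun es => m es.2
  -- There is an independent sample for each pair of an edge and a residue; the chain of residues
  -- selects which one is used.
  let val : (V → ZMod q) × (G.Dart × ZMod q → ℤ) → G.Dart → ℤ := fun z e =>
    z.2 (e, z.1 e.snd - z.1 e.fst)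
  have hval : ∀ e, Measurable fun z => val z e := by
    intro e
    have h1 : Measurable fun w : (G.Dart × ZMod q → ℤ) × ZMod q => w.1 (e, w.2) :=
      measurable_from_prod_countable_left fun s => measurable_pi_apply (e, s)
    have h2 : Measurable fun s : ZMod q × ZMod q => s.1 - s.2 := measurable_of_countable _
    have h3 : Measurable fun z : (V → ZMod q) × (G.Dart × ZMod q → ℤ) =>
        (z.1 e.snd, z.1 e.fst) :=
      ((measurable_pi_apply e.snd).comp measurable_fst).prodMk
        ((measurable_pi_apply e.fst).comp measurable_fst)
    exact h1.comp (measurable_snd.prodMk (h2.comp h3))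
  let η : (V → ZMod q) × (G.Dart × ZMod q → ℤ) → GradConfig G := fun z =>
    ⟨fun e => if e.fst < e.snd then val z e else -val z e.symm, fun e => by
      rcases lt_or_gt_of_ne e.adj.ne with h | h
      · simp [h, h.not_gt, Dart.symm_symm]
      · simp [h, h.not_gt]⟩
  have hη : Measurable η := by
    refine Measurable.subtype_mk (measurable_pi_lambda _ fun e => ?_)
    by_cases h : e.fst < e.snd
    · simpa only [h, if_true] using hval e
    · simp only [h, if_false]
      exact (hval e.symm).neg
  refine ⟨(P.prod M).map η, Measure.isProbabilityMeasure_map hη.aemeasurable, fun A hA ζ => ?_⟩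
  have hmeas : MeasurableSet {g : GradConfig G | ∀ e ∈ A, g.1 e = ζ e} := by
    have : {g : GradConfig G | ∀ e ∈ A, g.1 e = ζ e} =
        Subtype.val ⁻¹' {g : G.Dart → ℤ | ∀ e ∈ A, g e = ζ e} := rfl
    rw [this]
    exact measurable_subtype_coe (measurableSet_cylinder_eq A ζ)
  have hI := ofReal_integral_prod_incrementLaw hpos hs P A ζ
  have hInn : 0 ≤ ∫ σ, ∏ e ∈ A, incrementLaw Q q (ζ e) (σ e.snd - σ e.fst) ∂P :=
    integral_nonneg fun σ => Finset.prod_nonneg fun e _ => incrementLaw_nonneg hpos _ _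
  rw [measureReal_def, Measure.map_apply hη hmeas, Measure.prod_apply (hη hmeas),
    ← ENNReal.toReal_ofReal hInn, hI]
  congr 1
  refine lintegral_congr fun σ => ?_
  let rep : G.Dart → G.Dart := fun e => if e.fst < e.snd then e else e.symm
  -- As A never contains both orientations of an edge, its elements use distinct independent
  -- samples, and the conditional probability factorizes.
  have hrep : Set.InjOn rep A := by
    intro e he e' he' hee
    simp only [rep] at hee
    split_ifs at hee with h1 h2 h2
    · exact hee
    · exact absurd (hee ▸ he) (hA e' he')
    · exact absurd (hee ▸ he') (hA e he)
    · exact Dart.symm_involutive.injective hee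
  let t : G.Dart × ZMod q → Set ℤ := fun es => {if es.1 ∈ A then ζ es.1 else -ζ es.1.symm}
  have hset : Prod.mk σ ⁻¹' (η ⁻¹' {g | ∀ e ∈ A, g.1 e = ζ e}) =
      Set.pi (A.image fun e => (rep e, σ (rep e).snd - σ (rep e).fst)) t := by
    ext U
    simp only [Set.mem_preimage, Set.mem_ofPred_eq, Set.mem_pi, Finset.coe_image, Set.mem_image,
      Finset.mem_coe, forall_exists_index, and_imp, forall_apply_eq_imp_iff₂, t,
      Set.mem_singleton_iff]
    refine forall₂_congr fun e he => ?_
    by_cases h : e.fst < e.snd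
    · simp [η, val, rep, h, he]
    · simp only [η, val, rep, h, if_false, hA e he, Dart.symm_symm]
      exact neg_eq_iff_eq_neg
  rw [hset, Measure.infinitePi_pi _ fun _ _ => measurableSet_singleton _,
    Finset.prod_image fun e he e' he' hee => hrep he he' (Prod.mk.inj hee).1]
  refine Finset.prod_congr rfl fun e he => ?_
  by_cases h : e.fst < e.snd
  · simp only [rep, h, if_true, he, hm']
  · simp only [rep, h, if_false, hA e he, hm', Dart.symm_symm]
    congr 1
    rw [← incrementLaw_neg heven, neg_neg, neg_sub]
    rfl

theorem exists_isPeriodicGradientMeasure [G.LocallyFinite] (hG : G.IsTree)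
    (hreg : G.IsRegularOfDegree (d + 1)) (hpos : ∀ j, 0 < Q j) (heven : Function.Even Q)
    (hper : Function.Periodic lam (q : ℤ)) (h : IsHomBoundaryLaw d Q lam) :
    ∃ ν : Measure (GradConfig G), IsPeriodicGradientMeasure G Q heven q lam ν := by
  have hs := summable_of_isHomBoundaryLaw hpos hper h
  obtain ⟨y, c, hc, hy, hlam⟩ := (h.onResidues hper).exists_root (fuzzyQ_pos hpos hs)
  obtain ⟨P, hP⟩ := hy.exists_isBoundaryLawChain hG hreg (fuzzyQ_even heven q)
    Summable.of_finite hc hlam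
  have := hP.prob
  obtain ⟨ν, hν, hν'⟩ := exists_gradient_measure_of_residues (G := G) hpos heven hs P
  exact ⟨ν, hν, P, hP, hν'⟩

end FuzzyChain

/-! ### Concentration of sums of independent integers -/

section Concentration

theorem integral_fourier (n : ℤ) :
    ∫ t : UnitAddCircle, fourier n t ∂AddCircle.haarAddCircle = if n = 0 then 1 else 0 := by
  have h1 := congrFun (fourierCoeff_fourier (T := (1 : ℝ)) n) 0
  rw [fourierCoeff] at h1
  simp only [neg_zero, fourier_zero, one_smul] at h1
  rw [h1, Pi.single_apply]
  simp only [eq_comm]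

/-- A bound for the characteristic function of a law on `ℤ` that has two atoms at distance `q` of
mass at least `θ`. -/
def charBound (θ : ℝ) (q : ℤ) (t : UnitAddCircle) : ℝ := 1 - 2 * θ + θ * ‖1 + fourier q t‖

theorem norm_fourier_apply (n : ℤ) (t : UnitAddCircle) : ‖fourier n t‖ = 1 := by
  rw [fourier_apply]; exact Circle.norm_coe _

theorem continuous_charBound (θ : ℝ) (q : ℤ) : Continuous (charBound θ q) := by
  unfold charBound
  fun_prop

theorem charBound_le_one {θ : ℝ} (hθ : 0 ≤ θ) (q : ℤ) (t : UnitAddCircle) :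
    charBound θ q t ≤ 1 := by
  have h1 : ‖1 + fourier q t‖ ≤ 2 := by
    refine (norm_add_le _ _).trans ?_
    rw [norm_fourier_apply, norm_one]; norm_num
  unfold charBound
  nlinarith

/-- Mass θ is removed from each of the atoms a and a + q. The remaining non-negative weights
contribute at most 1 - 2θ, and the removed atoms contribute θ |e_a + e_(a+q)| = θ |1 + e_q|. -/
theorem norm_integral_fourier_le {m : Measure ℤ} [IsProbabilityMeasure m] {θ : ℝ} (hθ : 0 ≤ θ) {a q : ℤ}
    (hq : q ≠ 0) (h1 : θ ≤ m.real {a}) (h2 : θ ≤ m.real {a + q}) (t : UnitAddCircle) :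
    ‖∫ j, fourier j t ∂m‖ ≤ charBound θ q t := by
  have hint : Integrable (fun j : ℤ => (fourier j t : ℂ)) m :=
    Integrable.of_bound (measurable_of_countable _).aestronglyMeasurable 1
      (Eventually.of_forall fun j => (norm_fourier_apply j t).le)
  have hsum : HasSum (fun j => m.real {j}) 1 := by
    have := hasSum_measureReal_inter_preimage_singleton m MeasurableSet.univ measurable_id
    simpa using this
  let w : ℤ → ℝ := fun j =>
    m.real {j} - (Pi.single a θ : ℤ → ℝ) j - (Pi.single (a + q) θ : ℤ → ℝ) j
  have hw : HasSum w (1 - θ - θ) :=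
    (hsum.sub (hasSum_pi_single a θ)).sub (hasSum_pi_single (a + q) θ)
  have hw0 : ∀ j, 0 ≤ w j := by
    intro j
    simp only [w]
    by_cases hj : j = a
    · subst hj
      rw [Pi.single_eq_same, Pi.single_eq_of_ne (by omega)]
      linarith
    · by_cases hj' : j = a + q
      · subst hj'
        rw [Pi.single_eq_same, Pi.single_eq_of_ne hj]
        linarith
      · rw [Pi.single_eq_of_ne hj, Pi.single_eq_of_ne hj']
        simp
  have hf : HasSum (fun j => m.real {j} • (fourier j t : ℂ)) (∫ j, fourier j t ∂m) := by
    rw [integral_countable hint]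
    refine Summable.hasSum (Summable.of_norm ?_)
    refine hsum.summable.congr fun j => ?_
    rw [norm_smul, norm_fourier_apply, mul_one, Real.norm_of_nonneg measureReal_nonneg]
  have hsa : HasSum (fun j => (Pi.single a θ : ℤ → ℝ) j • (fourier j t : ℂ)) (θ • (fourier a t : ℂ)) := by
    have := hasSum_single (f := fun j => (Pi.single a θ : ℤ → ℝ) j • (fourier j t : ℂ)) a fun j hj => by
      rw [Pi.single_eq_of_ne hj, zero_smul]
    rwa [Pi.single_eq_same] at this
  have hsb : HasSum (fun j => (Pi.single (a + q) θ : ℤ → ℝ) j • (fourier j t : ℂ))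
      (θ • (fourier (a + q) t : ℂ)) := by
    have := hasSum_single (f := fun j => (Pi.single (a + q) θ : ℤ → ℝ) j • (fourier j t : ℂ)) (a + q)
      fun j hj => by rw [Pi.single_eq_of_ne hj, zero_smul]
    rwa [Pi.single_eq_same] at this
  have hdiff : HasSum (fun j => w j • (fourier j t : ℂ))
      ((∫ j, fourier j t ∂m) - θ • (fourier a t : ℂ) - θ • (fourier (a + q) t : ℂ)) :=
    ((hf.sub hsa).sub hsb).congr_fun fun j => by simp only [w, sub_smul]
  have hle := tsum_of_norm_bounded hw (f := fun j => w j • (fourier j t : ℂ)) fun j => by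
    rw [norm_smul, norm_fourier_apply, mul_one, Real.norm_of_nonneg (hw0 j)]
  rw [hdiff.tsum_eq] at hle
  have h3 : ‖θ • (fourier a t : ℂ) + θ • (fourier (a + q) t : ℂ)‖ = θ * ‖1 + fourier q t‖ := by
    rw [fourier_add, ← smul_add, norm_smul, Real.norm_of_nonneg hθ,
      show fourier a t + fourier a t * fourier q t = fourier a t * (1 + fourier q t) by ring,
      norm_mul, norm_fourier_apply, one_mul]
  calc ‖∫ j, fourier j t ∂m‖
      = ‖((∫ j, fourier j t ∂m) - θ • (fourier a t : ℂ) - θ • (fourier (a + q) t : ℂ)) +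
          (θ • (fourier a t : ℂ) + θ • (fourier (a + q) t : ℂ))‖ := by congr 1; ring
    _ ≤ (1 - θ - θ) + θ * ‖1 + fourier q t‖ := (norm_add_le _ _).trans (add_le_add hle h3.le)
    _ = charBound θ q t := by rw [charBound]; ring

theorem fourier_sum {ι : Type*} (s : Finset ι) (τ : ι → ℤ) (t : UnitAddCircle) :
    (fourier (∑ e ∈ s, τ e) t : ℂ) = ∏ e ∈ s, fourier (τ e) t := by
  classical
  induction s using Finset.induction_on with
  | empty => simp
  | insert e s he ih => rw [Finset.sum_insert he, Finset.prod_insert he, fourier_add, ih]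

/-- A concentration bound for sums of independent integer-valued variables. -/
theorem measureReal_pi_sum_eq_le {ι : Type*} [Fintype ι] (m : ι → Measure ℤ)
    [∀ e, IsProbabilityMeasure (m e)] {θ : ℝ} (hθ : 0 ≤ θ) {q : ℤ} (hq : q ≠ 0) (a : ι → ℤ)
    (h1 : ∀ e, θ ≤ (m e).real {a e}) (h2 : ∀ e, θ ≤ (m e).real {a e + q}) (k : ℤ) :
    (Measure.pi m).real {τ | ∑ e, τ e = k} ≤
      ∫ t, charBound θ q t ^ Fintype.card ι ∂AddCircle.haarAddCircle := by
  set μ := Measure.pi m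
  have hmeas : Measurable (Function.uncurry fun (τ : ι → ℤ) (t : UnitAddCircle) =>
      (fourier (∑ e, τ e - k) t : ℂ)) :=
    measurable_from_prod_countable_right fun τ => (map_continuous (fourier (∑ e, τ e - k))).measurable
  have hint : Integrable (Function.uncurry fun (τ : ι → ℤ) (t : UnitAddCircle) =>
      (fourier (∑ e, τ e - k) t : ℂ)) (μ.prod AddCircle.haarAddCircle) :=
    Integrable.of_bound hmeas.aestronglyMeasurable 1
      (Eventually.of_forall fun z => (norm_fourier_apply _ _).le)
  have hset : MeasurableSet {τ : ι → ℤ | ∑ e, τ e = k} := (Set.to_countable _).measurableSet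
  -- Fourier inversion: the indicator of {∑ τ = k} is the mean over the circle of the character of
  -- index ∑ τ - k. After exchanging the integrals, independence gives a product of characteristic
  -- functions.
  have e1 : ((μ.real {τ | ∑ e, τ e = k} : ℝ) : ℂ) =
      ∫ τ, ∫ t : UnitAddCircle, (fourier (∑ e, τ e - k) t : ℂ) ∂AddCircle.haarAddCircle ∂μ := by
    have h3 : ∀ τ : ι → ℤ,
        ∫ t : UnitAddCircle, (fourier (∑ e, τ e - k) t : ℂ) ∂AddCircle.haarAddCircle =
        Set.indicator {τ : ι → ℤ | ∑ e, τ e = k} (fun _ => (1 : ℂ)) τ := by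
      intro τ
      rw [integral_fourier (∑ e, τ e - k)]
      by_cases hτ : ∑ e, τ e = k
      · rw [if_pos (sub_eq_zero.2 hτ), Set.indicator_of_mem (by exact hτ)]
      · rw [if_neg (sub_ne_zero.2 hτ), Set.indicator_of_notMem (by exact hτ)]
    simp only [h3]
    rw [integral_indicator_const _ hset]
    simp
  rw [integral_integral_swap hint] at e1
  have e2 : ∀ t : UnitAddCircle, ∫ τ, (fourier (∑ e, τ e - k) t : ℂ) ∂μ =
      fourier (-k) t * ∏ e, ∫ j, (fourier j t : ℂ) ∂(m e) := by
    intro t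
    rw [← integral_fintype_prod_eq_prod, ← integral_const_mul]
    refine integral_congr_ae (Eventually.of_forall fun τ => ?_)
    simp only
    rw [sub_eq_neg_add, fourier_add, fourier_sum]
  simp only [e2] at e1
  have e3 := congrArg norm e1
  rw [Complex.norm_real, Real.norm_of_nonneg measureReal_nonneg] at e3
  rw [e3]
  refine norm_integral_le_of_norm_le ?_ (Eventually.of_forall fun t => ?_)
  · exact ((continuous_charBound θ q).pow _).integrable_of_hasCompactSupport
      (HasCompactSupport.of_compactSpace _)
  · rw [norm_mul, norm_fourier_apply, one_mul, norm_prod, ← Finset.card_univ, ← Finset.prod_const]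
    exact Finset.prod_le_prod (fun _ _ => norm_nonneg _) fun e _ =>
      norm_integral_fourier_le hθ hq (h1 e) (h2 e) t

instance UnitAddCircle.nontrivial : Nontrivial UnitAddCircle := by
  have h : Nontrivial (Set.Ico (0 : ℝ) (0 + 1)) :=
    ⟨⟨⟨0, by norm_num⟩, ⟨1 / 2, by norm_num⟩, fun h => by
      have := congrArg Subtype.val h
      norm_num at this⟩⟩
  exact (AddCircle.equivIco (1 : ℝ) 0).nontrivial

/-- The bound reaches 1 only if |1 + e_q(t)| = 2, that is, e_q(t) = 1 and q t = 0. These finitely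
many t form a Haar null set, and dominated convergence applies. -/
theorem tendsto_integral_charBound_pow {θ : ℝ} (hθ : 0 < θ) (hθ2 : 2 * θ ≤ 1) {q : ℕ} (hq : 0 < q) :
    Tendsto (fun n : ℕ => ∫ t, charBound θ q t ^ n ∂AddCircle.haarAddCircle) atTop (𝓝 0) := by
  have h0 : ∀ t, 0 ≤ charBound θ q t := fun t =>
    add_nonneg (by linarith) (mul_nonneg hθ.le (norm_nonneg _))
  have hlt : ∀ᵐ t ∂(AddCircle.haarAddCircle (T := (1 : ℝ))), charBound θ q t < 1 := by
    have hfin : {u : UnitAddCircle | q • u = 0}.Finite := AddCircle.finite_torsion 1 hq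
    have : (𝓝[≠] (0 : UnitAddCircle)).NeBot :=
      ConnectedSpace.neBot_nhdsWithin_compl_of_nontrivial_of_t1space 0
    have hnull := hfin.measure_zero (AddCircle.haarAddCircle (T := (1 : ℝ)))
    filter_upwards [measure_eq_zero_iff_ae_notMem.1 hnull] with t ht
    refine lt_of_le_of_ne (charBound_le_one hθ.le _ _) fun heq => ht ?_
    have h1 : ‖1 + fourier (q : ℤ) t‖ = 2 := by
      unfold charBound at heq
      have : θ * (‖1 + fourier (q : ℤ) t‖ - 2) = 0 := by linarith
      rcases mul_eq_zero.1 this with h | h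
      · exact absurd h hθ.ne'
      · linarith
    have h2 := norm_fourier_apply (q : ℤ) t
    have h3 : (fourier (q : ℤ) t : ℂ) = 1 := by
      have h4 : ‖1 + (fourier (q : ℤ) t : ℂ)‖ ^ 2 = 4 := by rw [h1]; norm_num
      have h5 : ‖(fourier (q : ℤ) t : ℂ)‖ ^ 2 = 1 := by rw [h2]; norm_num
      rw [Complex.sq_norm, Complex.normSq_apply] at h4 h5
      simp only [Complex.add_re, Complex.one_re, Complex.add_im, Complex.one_im, zero_add] at h4
      have h6 : (fourier (q : ℤ) t : ℂ).re = 1 := by nlinarith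
      have h7 : (fourier (q : ℤ) t : ℂ).im = 0 := by
        rw [h6] at h5
        nlinarith
      exact Complex.ext h6 h7
    rw [fourier_apply] at h3
    have h4 : AddCircle.toCircle ((q : ℤ) • t) =
        AddCircle.toCircle (0 : UnitAddCircle) := by
      rw [AddCircle.toCircle_zero]
      exact Circle.ext (by rw [h3, Circle.coe_one])
    have h5 := AddCircle.injective_toCircle one_ne_zero h4
    rwa [natCast_zsmul] at h5
  have h1 := tendsto_integral_of_dominated_convergence (μ := AddCircle.haarAddCircle (T := (1 : ℝ)))
    (F := fun (n : ℕ) t => charBound θ q t ^ n) (f := fun _ => 0) (fun _ => 1)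
    (fun n => ((continuous_charBound θ q).pow n).aestronglyMeasurable) (integrable_const _)
    (fun n => Eventually.of_forall fun t => by
      rw [Real.norm_of_nonneg (pow_nonneg (h0 t) n)]
      exact pow_le_one₀ (h0 t) (charBound_le_one hθ.le _ _))
    (by
      filter_upwards [hlt] with t ht
      exact tendsto_pow_atTop_nhds_zero_of_lt_one (h0 t) ht)
  simpa using h1

end Concentration

/-! ### Delocalization of periodic gradient measures -/

section Delocalization

open SimpleGraph

variable {V : Type*} {G : SimpleGraph V}

theorem SimpleGraph.Walk.IsPath.symm_notMem_darts {x y : V} {p : G.Walk x y} (hp : p.IsPath)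
    {e : G.Dart} (he : e ∈ p.darts) : e.symm ∉ p.darts := by
  intro he'
  have h1 : (p.darts.map Dart.edge).Nodup := hp.isTrail.edges_nodup
  exact e.symm_ne (List.inj_on_of_nodup_map h1 he' he (by simp))

theorem SimpleGraph.Walk.IsPath.nodup_darts {x y : V} {p : G.Walk x y} (hp : p.IsPath) :
    p.darts.Nodup :=
  List.Nodup.of_map Dart.edge hp.isTrail.edges_nodup

theorem totalIncrement_eq_sum [DecidableEq G.Dart] {x y : V} {p : G.Walk x y} (hp : p.IsPath)
    (η : GradConfig G) : totalIncrement p η = ∑ e : p.darts.toFinset, η.1 e := by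
  rw [totalIncrement, ← List.sum_toFinset _ hp.nodup_darts, Finset.sum_coe_sort _ η.1]

theorem totalIncrement_gradProj {x y : V} (p : G.Walk x y) (σ : V → ℤ) :
    totalIncrement p (gradProj G σ) = σ y - σ x := by
  induction p with
  | nil => simp [totalIncrement]
  | cons h q ih =>
    simp only [totalIncrement, Walk.darts_cons, List.map_cons, List.sum_cons] at ih ⊢
    rw [ih]
    simp [gradProj]

theorem measurable_totalIncrement {x y : V} (p : G.Walk x y) :
    Measurable (totalIncrement p) := by
  have h : ∀ l : List G.Dart, Measurable fun η : GradConfig G => (l.map η.1).sum := by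
    intro l
    induction l with
    | nil => simp
    | cons e l ih =>
      simp only [List.map_cons, List.sum_cons]
      exact ((measurable_pi_apply e).comp measurable_subtype_coe).add ih
  exact h p.darts

variable {q d : ℕ} [NeZero q] {Q lam : ℤ → ℝ} [G.LocallyFinite]

/-- The law of the total increment along a path is a mixture of laws of sums of independent
increments. -/
theorem IsPeriodicGradientMeasure.measureReal_totalIncrement_le (hpos : ∀ j, 0 < Q j)
    {heven : Function.Even Q} (hs : Summable Q) {ν : Measure (GradConfig G)}
    (hν : IsPeriodicGradientMeasure G Q heven q lam ν) {θ : ℝ} (hθ : 0 ≤ θ)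
    (h1 : ∀ s : ZMod q, θ ≤ incrementLaw Q q s.val s)
    (h2 : ∀ s : ZMod q, θ ≤ incrementLaw Q q (s.val + q) s) {x y : V} {p : G.Walk x y}
    (hp : p.IsPath) (k : ℤ) :
    ν.real {η | totalIncrement p η = k} ≤
      ∫ t, charBound θ q t ^ p.length ∂AddCircle.haarAddCircle := by
  classical
  obtain ⟨m, hm, hm'⟩ := exists_incrementMeasure (q := q) hpos hs
  have := hν.prob
  obtain ⟨P, hP, hmarg⟩ := hν.marginal
  have := hP.prob
  set A := p.darts.toFinset with hA
  set b := ∫ t, charBound θ q t ^ p.length ∂AddCircle.haarAddCircle with hb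
  have hAsymm : ∀ e ∈ A, e.symm ∉ A := fun e he => by
    rw [hA, List.mem_toFinset] at he ⊢
    exact hp.symm_notMem_darts he
  have hcard : Fintype.card A = p.length := by
    rw [Fintype.card_coe, hA, List.toFinset_card_of_nodup hp.nodup_darts, Walk.length_darts]
  -- The conditional law of the increments along the path given the fuzzy chain σ. The concentration
  -- bound for it is uniform in σ, so it survives averaging over the chain.
  let pr : (V → ZMod q) → Measure (A → ℤ) := fun σ =>
    Measure.pi fun e : A => m (σ e.1.snd - σ e.1.fst)
  have hpr : ∀ σ τ, pr σ {τ} = ∏ e : A, m (σ e.1.snd - σ e.1.fst) {τ e} := fun σ τ =>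
    Measure.pi_singleton _ τ
  have hprm : ∀ τ, Measurable fun σ => pr σ {τ} := by
    intro τ
    simp only [hpr]
    refine Finset.measurable_fun_prod _ fun e _ => ?_
    have h3 : Measurable fun s : ZMod q × ZMod q => m (s.1 - s.2) {τ e} :=
      measurable_of_countable _
    exact h3.comp ((measurable_pi_apply e.1.snd).prodMk (measurable_pi_apply e.1.fst) :
      Measurable fun σ : V → ZMod q => (σ e.1.snd, σ e.1.fst))
  let B : Set (A → ℤ) := {τ | ∑ e, τ e = k}
  have hB : MeasurableSet B := (Set.to_countable _).measurableSet
  have hBle : ∀ σ, pr σ B ≤ ENNReal.ofReal b := by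
    intro σ
    have h3 := measureReal_pi_sum_eq_le (fun e : A => m (σ e.1.snd - σ e.1.fst)) hθ
      (q := q) (by exact_mod_cast NeZero.ne q)
      (fun e => ((σ e.1.snd - σ e.1.fst).val : ℤ))
      (fun e => by
        rw [measureReal_def, hm', ENNReal.toReal_ofReal (incrementLaw_nonneg hpos _ _)]
        exact h1 _)
      (fun e => by
        rw [measureReal_def, hm', ENNReal.toReal_ofReal (incrementLaw_nonneg hpos _ _)]
        exact h2 _) k
    rw [hcard] at h3
    rw [← ofReal_measureReal (μ := pr σ) (s := B)]
    exact ENNReal.ofReal_le_ofReal h3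
  let f : GradConfig G → A → ℤ := fun η e => η.1 e
  have hf : Measurable f := measurable_pi_lambda _ fun e =>
    (measurable_pi_apply e.1).comp measurable_subtype_coe
  have hfτ : ∀ τ : A → ℤ, ν.map f {τ} = ∫⁻ σ, pr σ {τ} ∂P := by
    intro τ
    let ζ : G.Dart → ℤ := fun e => if h : e ∈ A then τ ⟨e, h⟩ else 0
    have hζ : ∀ e : A, ζ e = τ e := fun e => dif_pos e.2
    have h3 : f ⁻¹' {τ} = {η | ∀ e ∈ A, η.1 e = ζ e} := by
      ext η
      simp only [Set.mem_preimage, Set.mem_singleton_iff, Set.mem_ofPred_eq, funext_iff, f]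
      constructor
      · intro h e he; rw [h ⟨e, he⟩, ← hζ]
      · intro h e; rw [h e e.2, hζ]
    rw [Measure.map_apply hf (measurableSet_singleton τ), h3, ← ofReal_measureReal,
      hmarg A hAsymm ζ, ofReal_integral_prod_incrementLaw hpos hs]
    refine lintegral_congr fun σ => ?_
    rw [hpr, ← Finset.prod_coe_sort]
    exact Finset.prod_congr rfl fun e _ => by rw [hm', hζ]
  have hW : {η : GradConfig G | totalIncrement p η = k} = f ⁻¹' B := by
    ext η
    simp only [Set.mem_ofPred_eq, Set.mem_preimage, f, B, totalIncrement_eq_sum hp]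
    rfl
  have hle : ν {η | totalIncrement p η = k} ≤ ENNReal.ofReal b := by
    rw [hW, ← Measure.map_apply hf hB, ← Measure.tsum_indicator_apply_singleton _ B hB]
    calc ∑' τ, B.indicator (fun τ => ν.map f {τ}) τ
        = ∑' τ, ∫⁻ σ, B.indicator (fun τ => pr σ {τ}) τ ∂P := by
          refine tsum_congr fun τ => ?_
          by_cases hτ : τ ∈ B
          · simp only [Set.indicator_of_mem hτ, hfτ]
          · simp only [Set.indicator_of_notMem hτ, lintegral_zero]
      _ = ∫⁻ σ, ∑' τ, B.indicator (fun τ => pr σ {τ}) τ ∂P := by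
          rw [lintegral_tsum fun τ => ?_]
          by_cases hτ : τ ∈ B
          · simp only [Set.indicator_of_mem hτ]
            exact (hprm τ).aemeasurable
          · simp only [Set.indicator_of_notMem hτ]
            exact aemeasurable_const
      _ ≤ ∫⁻ _, ENNReal.ofReal b ∂P := by
          refine lintegral_mono fun σ => ?_
          rw [Measure.tsum_indicator_apply_singleton _ B hB]
          exact hBle σ
      _ = ENNReal.ofReal b := by simp
  -- The bound b is non-negative because, by the same concentration inequality, it dominates a
  -- probability.
  have hb0 : 0 ≤ b := by
    by_contra hneg
    have h4 := measureReal_pi_sum_eq_le (fun e : A => m 0) hθ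
      (q := q) (by exact_mod_cast NeZero.ne q) (fun e => ((0 : ZMod q).val : ℤ))
      (fun e => by
        rw [measureReal_def, hm', ENNReal.toReal_ofReal (incrementLaw_nonneg hpos _ _)]
        exact h1 _)
      (fun e => by
        rw [measureReal_def, hm', ENNReal.toReal_ofReal (incrementLaw_nonneg hpos _ _)]
        exact h2 _) k
    rw [hcard] at h4
    exact hneg (measureReal_nonneg.trans h4)
  rw [measureReal_def]
  exact ENNReal.toReal_le_of_le_ofReal hb0 hle

theorem IsPeriodicGradientMeasure.tendsto_measureReal_totalIncrement (hpos : ∀ j, 0 < Q j)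
    {heven : Function.Even Q} (hs : Summable Q) {ν : Measure (GradConfig G)}
    (hν : IsPeriodicGradientMeasure G Q heven q lam ν) (k : ℤ) (x y : ℕ → V)
    (p : ∀ n, G.Walk (x n) (y n)) (hp : ∀ n, (p n).IsPath ∧ (p n).length = n) :
    Tendsto (fun n => ν.real {η | totalIncrement (p n) η = k}) atTop (𝓝 0) := by
  have hq : 0 < q := Nat.pos_of_ne_zero (NeZero.ne q)
  -- The two atoms in the class s are its representatives s.val and s.val + q. Their masses are
  -- positive, and since there are finitely many classes, the smallest of them can serve as θ.
  obtain ⟨s, hs'⟩ := Finite.exists_min fun s : ZMod q =>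
    min (incrementLaw Q q s.val s) (incrementLaw Q q (s.val + q) s)
  have hc1 : ((s.val : ℤ) : ZMod q) = s := intCast_val s
  have hc2 : ((s.val + q : ℤ) : ZMod q) = s := by
    rw [Int.cast_add, hc1, Int.cast_natCast, ZMod.natCast_self, add_zero]
  set θ := min (incrementLaw Q q s.val s) (incrementLaw Q q (s.val + q) s) with hθ
  have hθ0 : 0 < θ := lt_min (incrementLaw_pos hpos hs hc1) (incrementLaw_pos hpos hs hc2)
  -- Two distinct atoms of a probability law both have mass at least θ.
  have hθ2 : 2 * θ ≤ 1 := by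
    have h1 := sum_le_hasSum {(s.val : ℤ), (s.val : ℤ) + q}
      (fun j _ => incrementLaw_nonneg hpos j s) (hasSum_incrementLaw hpos hs s)
    rw [Finset.sum_pair (by omega)] at h1
    have h2 := min_le_left (incrementLaw Q q s.val s) (incrementLaw Q q (s.val + q) s)
    have h3 := min_le_right (incrementLaw Q q s.val s) (incrementLaw Q q (s.val + q) s)
    linarith
  refine squeeze_zero (fun n => measureReal_nonneg) (fun n => ?_)
    (tendsto_integral_charBound_pow hθ0 hθ2 hq)
  have h1 := hν.measureReal_totalIncrement_le hpos hs hθ0.le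
    (fun s => (hs' s).trans (min_le_left _ _)) (fun s => (hs' s).trans (min_le_right _ _))
    (hp n).1 k
  rwa [(hp n).2] at h1

end Delocalization

end

/-! ### Proof of the theorem -/

theorem theorem3p5 {V : Type*} (G : SimpleGraph V) [G.LocallyFinite] (d : ℕ) (hd : 2 ≤ d)
    (hG : G.IsTree) (hreg : G.IsRegularOfDegree (d + 1))
    (Q : ℤ → ℝ) (hpos : ∀ j, 0 < Q j) (heven : Function.Even Q) (hzero : Q 0 = 1) :
    -- gradient measures of height-periodic boundary laws delocalize
    (∀ (q : ℕ) [NeZero q] (lamq : ℤ → ℝ), Function.Periodic lamq (q : ℤ) →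
      IsHomBoundaryLaw d Q lamq →
      (∃ ν : Measure (GradConfig G), IsPeriodicGradientMeasure G Q heven q lamq ν) ∧
      ∀ ν : Measure (GradConfig G), IsPeriodicGradientMeasure G Q heven q lamq ν →
        ∀ (k : ℤ) (x y : ℕ → V) (p : ∀ n, G.Walk (x n) (y n)),
          (∀ n, (p n).IsPath ∧ (p n).length = n) →
          Tendsto (fun n => ν.real {η | totalIncrement (p n) η = k}) atTop (𝓝 0)) ∧
    -- gradient projections of the localized Gibbs measures localize, and the two kinds differ
    (MemEll (((d : ℝ) + 1) / 2) Set.univ Q →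
      (ellNorm (((d : ℝ) + 1) / 2) Set.univ Q, ellNorm ((d : ℝ) + 1) {0}ᶜ Q) ∈ goodSet d →
      (∃ lam : ℤ → ℝ, IsLocalizedBoundaryLaw d Q lam) ∧
      ∀ lam : ℤ → ℝ, IsLocalizedBoundaryLaw d Q lam → ∀ i : ℤ,
      (∃ μ : Measure (V → ℤ), IsLocalizedGibbsMeasure G Q heven lam i μ) ∧
      ∀ μ : Measure (V → ℤ), IsLocalizedGibbsMeasure G Q heven lam i μ →
        (∀ k : ℤ,
          0 < ∑' j, stationaryLaw d lam j * stationaryLaw d lam (j + k) ∧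
          ∀ (x y : ℕ → V) (p : ∀ n, G.Walk (x n) (y n)),
            (∀ n, (p n).IsPath ∧ (p n).length = n) →
            Tendsto (fun n => (μ.map (gradProj G)).real {η | totalIncrement (p n) η = k}) atTop
              (𝓝 (∑' j, stationaryLaw d lam j * stationaryLaw d lam (j + k)))) ∧
        ∀ (q : ℕ) [NeZero q] (lamq : ℤ → ℝ), Function.Periodic lamq (q : ℤ) →
          IsHomBoundaryLaw d Q lamq →
          ∀ ν : Measure (GradConfig G), IsPeriodicGradientMeasure G Q heven q lamq ν →
            ν ≠ μ.map (gradProj G)) := by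
  have hdeg : ∀ v, 2 ≤ G.degree v := fun v => by rw [hreg.degree_eq v]; omega
  have hdeloc : ∀ (q : ℕ) [NeZero q] (lamq : ℤ → ℝ), Function.Periodic lamq (q : ℤ) →
      IsHomBoundaryLaw d Q lamq → ∀ ν : Measure (GradConfig G),
      IsPeriodicGradientMeasure G Q heven q lamq ν →
        ∀ (k : ℤ) (x y : ℕ → V) (p : ∀ n, G.Walk (x n) (y n)),
          (∀ n, (p n).IsPath ∧ (p n).length = n) →
          Tendsto (fun n => ν.real {η | totalIncrement (p n) η = k}) atTop (𝓝 0) :=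
    fun q _ lamq hper hlam ν hν => hν.tendsto_measureReal_totalIncrement hpos
      (summable_of_isHomBoundaryLaw hpos hper hlam)
  refine ⟨fun q _ lamq hper hlam => ⟨exists_isPeriodicGradientMeasure hG hreg hpos heven hper hlam,
    hdeloc q lamq hper hlam⟩, fun hQ hgood => ⟨?_, fun lam hlam i => ?_⟩⟩
  · obtain ⟨-, -, ε, hε⟩ := hgood
    exact exists_isLocalizedBoundaryLaw (by omega) hpos hQ hε
  obtain ⟨X, C, hX, hXs, hlamX⟩ := hlam.exists_root (by omega) hpos heven hzero hQ
  have hXi := hX.translate i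
  have hXis : Summable fun j => X (j - i) ^ (d + 1) :=
    (Equiv.subRight i).summable_iff (f := fun j => X j ^ (d + 1)) |>.2 hXs
  have hlami : ∀ j, lam (j - i) = 1 * X (j - i) ^ d := fun j => by rw [hlamX, one_mul]
  refine ⟨hXi.exists_isBoundaryLawChain hG hreg heven hXis one_pos hlami, fun μ hμ => ?_⟩
  have hlim : ∀ k : ℤ, 0 < ∑' j, stationaryLaw d lam j * stationaryLaw d lam (j + k) ∧
      ∀ (x y : ℕ → V) (p : ∀ n, G.Walk (x n) (y n)),
        (∀ n, (p n).IsPath ∧ (p n).length = n) →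
        Tendsto (fun n => (μ.map (gradProj G)).real {η | totalIncrement (p n) η = k}) atTop
          (𝓝 (∑' j, stationaryLaw d lam j * stationaryLaw d lam (j + k))) := by
    intro k
    rw [stationaryLaw_eq_invariantLaw (by omega) hX.pos hlamX]
    constructor
    · have hα := hX.invariantLaw_pos hXs
      have hα1 := hX.hasSum_invariantLaw hXs
      refine Summable.tsum_pos (hα1.summable.mul_bounded (M := 1) (fun j => (hα j).le) fun j => ?_)
        (fun j => (mul_pos (hα _) (hα _)).le) 0 (mul_pos (hα _) (hα _))
      rw [abs_of_pos (hα _)]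
      exact le_hasSum hα1 _ fun l _ => (hα l).le
    · intro x y p hp
      have h1 := IsBoundaryLawChain.tendsto_measureReal_sub_eq hG.isAcyclic hreg hXi hXis one_pos
        hlami hμ k x y p hp
      have h2 : ∑' j, invariantLaw d (fun j => X (j - i)) j *
          invariantLaw d (fun j => X (j - i)) (j + k) =
          ∑' j, invariantLaw d X j * invariantLaw d X (j + k) := by
        rw [← (Equiv.subRight i).tsum_eq fun j => invariantLaw d X j * invariantLaw d X (j + k)]
        refine tsum_congr fun j => ?_
        rw [invariantLaw_translate, invariantLaw_translate, Equiv.subRight_apply, sub_add_eq_add_sub]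
      rw [h2] at h1
      refine h1.congr fun n => ?_
      have h3 : MeasurableSet {η : GradConfig G | totalIncrement (p n) η = k} :=
        measurable_totalIncrement (p n) (measurableSet_singleton k)
      rw [measureReal_def, measureReal_def, Measure.map_apply (measurable_gradProj G) h3]
      simp only [Set.preimage_ofPred_eq, totalIncrement_gradProj]
  refine ⟨hlim, fun q _ lamq hper hlamq ν hν hνμ => ?_⟩
  have := hG.1.nonempty
  -- Along any choice of paths of every length, the probability of {W_n = 0} would tend both to 0
  -- and to a positive number.
  choose x y p hp using hG.isAcyclic.exists_isPath_length_eq hdeg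
  have h1 := hdeloc q lamq hper hlamq ν hν 0 x y p hp
  rw [hνμ] at h1
  exact (hlim 0).1.ne (tendsto_nhds_unique h1 ((hlim 0).2 x y p hp))
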